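/- **Setting.** For a map $g\colon[-1,1]\to[-1,1]$, derivatives and analyticity at $\pm1$ are one-sided (within $[-1,1]$), and $\mathrm{Crit}(g)=\{x: g'(x)=0\}$. A critical point $p$ is *non-flat* if there are $\alpha^{\pm}>0$, $M>0$, $\delta>0$ with $\left|\log\frac{|g'(x)|}{|x-p|^{\alpha^{+}}}\right|\le M$ for $x\in(p,p+\delta)$ and $\left|\log\frac{|g'(x)|}{|x-p|^{\alpha^{-}}}\right|\le M$ for $x\in(p-\delta,p)$. A point $c$ is a *Lorenz-like singularity* of $g$ if there are $\ell^{\pm}\in(0,1)$, $L>0$, $\delta>0$ with $\frac{1}{L|x-c|^{\ell^+}}\le|g'(x)|\le\frac{L}{|x-c|^{\ell^+}}$ for $x\in(c,c+\delta)$ and the same with $\ell^-$ for $x\in(c-\delta,c)$. Write $\mathcal O_g(x)=\{g^n(x):n\ge0\}$. A continuous map $g$ is *unimodal with turning point* $c\in(-1,1)$ if it is strictly increasing on $[-1,c)$ and strictly decreasing on $(c,1]$; then $\mathcal S(g)=\mathrm{Crit}(g)\cup\{c\}$. Its kneading invariant is $(e_j)_{j\ge1}$, where $e_j=0$ (resp.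 $1$) if $g^j(y)<c$ (resp. $g^j(y)>c$) for all $y>c$ close enough to $c$. The map $g$ has *Fibonacci recurrence* if its kneading map is $Q(k)=\max\{0,k-2\}$, that is: with $S(0)=1$ and $S(k)=S(k-1)+S(Q(k))$ for $k\ge1$, one has $e_1=1$ and $e_{S(k-1)+1}\cdots e_{S(k)}=e_1\cdots e_{S(Q(k))-1}(1-e_{S(Q(k))})$ for all $k\ge1$. **Theorem.** Let $\lambda_F\in(0,2]$ be such that the tent map $T(x)=\lambda_F(1-|x|)-1$ of $[-1,1]$ has Fibonacci recurrence, and let $\mu_P$ be the ergodic $T$-invariant probability measure supported on $\overline{\mathcal O_T(0)}$. Let $h\colon[-1,1]\to[-1,1]$ be a homeomorphism that is real analytic on $[-1,1]\setminus\{0\}$ and whose unique critical point is $0$, this critical point being non-flat. Put $f=h\circ T\circ h^{-1}$, $\tilde c=h(0)$, $\tilde\mu_P=h_*\mu_P$ and $\mathcal S(f)=\mathrm{Crit}(f)\cup\{\tilde c\}$. Then $f$ is unimodal with turning point $\tilde c$ if $h$ is increasing, and unimodal upside down (continuous, decreasing on $[-1,\tilde c)$, increasing on $(\tilde c,1]$,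 with $\tilde c\in(-1,1)$) if $h$ is decreasing; $f$ is analytic outside $\mathcal S(f)$; $f$ has a Lorenz-like singularity at $\tilde c$; and: 1. The Lyapunov exponent $\int\log|f'|\,d\tilde\mu_P$ is not defined, not even as $\pm\infty$: both the positive and the negative part of $\log|f'|$ have infinite integral. 2. Let $x\in\overline{\mathcal O_f(\tilde c)}$. If $\mathcal O_f(x)\cap\mathcal S(f)=\emptyset$, then $\lim_{n\to\infty}\frac1n\log|(f^n)'(x)|$ does not exist in $[-\infty,+\infty]$. If $\mathcal O_f(x)\cap\mathcal S(f)\ne\emptyset$, then the pointwise Lyapunov exponent of $f$ at $x$ is not defined: for all large $n$, $f^n$ is not differentiable at $x$. 3. $\log\operatorname{dist}(\cdot,\mathcal S(f))\notin L^1(\tilde\mu_P)$. 4. The orbit of $\tilde c$ recurs exponentially: $f^n(\tilde c)\ne\tilde c$ for all $n\ge1$, and $$\limsup_{n\to\infty}\frac{-\log|f^n(\tilde c)-\tilde c|}{n}\in(0,+\infty).$$ -/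

import Mathlib

open Set Filter Topology MeasureTheory

namespace LyapunovFibonacci

/-- The interval `[-1,1]`. -/
abbrev Seg : Type := Set.Icc (-1 : ℝ) 1

/-- The point `0` of `[-1,1]`. -/
def origin : Seg := ⟨0, by norm_num, by norm_num⟩

/-- A self-map of `[-1,1]` as a real function: it is extended constantly beyond `[-1,1]`, and is only
ever differentiated, or expanded in a power series, within `[-1,1]`. -/
noncomputable def toReal (g : Seg → Seg) : ℝ → ℝ :=
  Set.IccExtend (by norm_num : (-1 : ℝ) ≤ 1) (fun x => (g x : ℝ))

/-- `g` is differentiable at `x` (one-sidedly at `-1` and `1`). -/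
def DiffAt (g : Seg → Seg) (x : Seg) : Prop :=
  DifferentiableWithinAt ℝ (toReal g) (Icc (-1) 1) x

/-- The derivative `g'(x)` (one-sided at `-1` and `1`). -/
noncomputable def der (g : Seg → Seg) (x : Seg) : ℝ :=
  derivWithin (toReal g) (Icc (-1) 1) x

/-- `g` is real analytic at `x`: near `x`, on `[-1,1]`, it is the sum of a power series. -/
def AnalyticPt (g : Seg → Seg) (x : Seg) : Prop :=
  AnalyticWithinAt ℝ (toReal g) (Icc (-1) 1) x

/-- `f` is unimodal with turning point `c`. -/
def IsUnimodal (f : Seg → Seg) (c : Seg) : Prop :=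
  Continuous f ∧ (-1 : ℝ) < c ∧ (c : ℝ) < 1 ∧ StrictMonoOn f (Iio c) ∧ StrictAntiOn f (Ioi c)

/-- `f` is unimodal with turning point `c`, upside down: it decreases and then increases. -/
def IsReversedUnimodal (f : Seg → Seg) (c : Seg) : Prop :=
  Continuous f ∧ (-1 : ℝ) < c ∧ (c : ℝ) < 1 ∧ StrictAntiOn f (Iio c) ∧ StrictMonoOn f (Ioi c)

/-- `c` is a Lorenz-like singularity of `f`. (The lower bounds are positive, so that they contain the
differentiability of `f` at `x`.) -/
def IsLorenzLike (f : Seg → Seg) (c : Seg) : Prop :=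
  ∃ r ∈ Ioo (0 : ℝ) 1, ∃ l ∈ Ioo (0 : ℝ) 1, ∃ L > (0 : ℝ), ∃ δ > (0 : ℝ),
    (∀ x : Seg, (c : ℝ) < x → (x : ℝ) < c + δ →
      1 / (L * |(x : ℝ) - c| ^ r) ≤ |der f x| ∧ |der f x| ≤ L / |(x : ℝ) - c| ^ r) ∧
    (∀ x : Seg, (c : ℝ) - δ < x → (x : ℝ) < c →
      1 / (L * |(x : ℝ) - c| ^ l) ≤ |der f x| ∧ |der f x| ≤ L / |(x : ℝ) - c| ^ l)

/-- The set of critical points: the derivative exists and vanishes. -/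
def Crit (f : Seg → Seg) : Set Seg :=
  {x | HasDerivWithinAt (toReal f) 0 (Icc (-1) 1) x}

/-- `p` is a non-flat critical point of `f`. (`der f x ≠ 0` says that the logarithm is finite.) -/
def IsNonflatCritical (f : Seg → Seg) (p : Seg) : Prop :=
  p ∈ Crit f ∧
  ∃ r > (0 : ℝ), ∃ l > (0 : ℝ), ∃ M > (0 : ℝ), ∃ δ > (0 : ℝ),
    (∀ x : Seg, (p : ℝ) < x → (x : ℝ) < p + δ →
      der f x ≠ 0 ∧ |Real.log (|der f x| / |(x : ℝ) - p| ^ r)| ≤ M) ∧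
    (∀ x : Seg, (p : ℝ) - δ < x → (x : ℝ) < p →
      der f x ≠ 0 ∧ |Real.log (|der f x| / |(x : ℝ) - p| ^ l)| ≤ M)

/-- The set `S(f)` of critical points of `f`, together with the turning point `c`. -/
def SingSet (f : Seg → Seg) (c : Seg) : Set Seg := Crit f ∪ {c}

/-- The forward orbit of `x`. -/
def orbit (f : Seg → Seg) (x : Seg) : Set Seg := Set.range (fun n : ℕ => f^[n] x)

/-- The symbols `0`, `1` and `c` of itineraries. -/
inductive Symbol
  | zero
  | one
  | turn

/-- The exchange `a ↦ 1 - a` of the symbols `0` and `1`. -/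
def Symbol.flip : Symbol → Symbol
  | .zero => .one
  | .one => .zero
  | .turn => .turn

open Classical in
/-- The `n`-th symbol of the itinerary of `x` under `f`, relative to the turning point `c`. -/
noncomputable def itinerary (f : Seg → Seg) (c x : Seg) (n : ℕ) : Symbol :=
  if f^[n] x < c then .zero else if c < f^[n] x then .one else .turn

/-- `e 1, e 2, …` is the kneading invariant of `f`: `e j` is the limit of the `j`-th symbol of the
itinerary of `y` as `y` decreases to `c`. -/
def IsKneadingInvariant (f : Seg → Seg) (c : Seg) (e : ℕ → Symbol) : Prop :=
  ∀ j, 1 ≤ j → ∀ᶠ y in 𝓝[>] c, itinerary f c y j = e j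

/-- `S` is the sequence with `S 0 = 1` and `S k = S (k-1) + S (Q k)` for `k ≥ 1`. -/
def IsCuttingTimes (Q S : ℕ → ℕ) : Prop :=
  S 0 = 1 ∧ ∀ k, 1 ≤ k → S k = S (k - 1) + S (Q k)

/-- `e 1, e 2, …` is the kneading sequence associated to `Q`, where `S` is the sequence of cutting
times of `Q`: `e 1 = 1`, and for `k ≥ 1` the block `e (S (k-1) + 1) … e (S k)` is
`e 1 … e (S (Q k))` with its last symbol exchanged. -/
def IsKneadingSequence (Q S : ℕ → ℕ) (e : ℕ → Symbol) : Prop :=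
  e 1 = .one ∧ ∀ k, 1 ≤ k →
    (∀ j, 1 ≤ j → j < S (Q k) → e (S (k - 1) + j) = e j) ∧
    e (S k) = (e (S (Q k))).flip

/-- `Q` is the kneading map of the unimodal map `f` with turning point `c`. -/
def HasKneadingMap (f : Seg → Seg) (c : Seg) (Q : ℕ → ℕ) : Prop :=
  IsUnimodal f c ∧ (∀ k, 1 ≤ k → Q k < k) ∧
  ∃ (S : ℕ → ℕ) (e : ℕ → Symbol),
    IsCuttingTimes Q S ∧ IsKneadingInvariant f c e ∧ IsKneadingSequence Q S e

/-- Fibonacci recurrence: the kneading map is `k ↦ max 0 (k - 2)` (here `-` truncates at `0`). -/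
def HasFibonacciRecurrence (f : Seg → Seg) (c : Seg) : Prop :=
  HasKneadingMap f c (fun k => k - 2)

/-- The tent map `x ↦ s (1 - |x|) - 1` of `[-1,1]`, for `s ∈ (0,2]`. -/
noncomputable def tent (s : ℝ) (hs : s ∈ Ioc (0 : ℝ) 2) : Seg → Seg := fun x =>
  ⟨s * (1 - |(x : ℝ)|) - 1, by
    have h0 := hs.1
    have h2 := hs.2
    have h3 : |(x : ℝ)| ≤ 1 := abs_le.2 ⟨x.2.1, x.2.2⟩
    have h4 := abs_nonneg (x : ℝ)
    constructor
    · nlinarith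
    · nlinarith⟩

/-- The Lyapunov exponent `∫ log |f'| dμ` is defined, possibly as `+∞` or `-∞`: the positive part or
the negative part of `log |f'|` has a finite integral. -/
def LyapunovExponentDefined (f : Seg → Seg) (μ : Measure Seg) : Prop :=
  ∫⁻ x, ENNReal.ofReal (Real.log |der f x|) ∂μ < ⊤ ∨
  ∫⁻ x, ENNReal.ofReal (-Real.log |der f x|) ∂μ < ⊤

/-- The numbers `(1/n) log |(f^n)'(x)|` converge to `L`, which may be infinite. -/
def HasPointwiseExponent (f : Seg → Seg) (x : Seg) (L : EReal) : Prop :=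
  Tendsto (fun n : ℕ => (((1 / (n : ℝ)) * Real.log |der f^[n] x| : ℝ) : EReal)) atTop (𝓝 L)

/-- Exponential recurrence of the orbit of `c`. -/
def HasExponentialRecurrence (f : Seg → Seg) (c : Seg) : Prop :=
  (∀ n : ℕ, 1 ≤ n → f^[n] c ≠ c) ∧
  limsup (fun n : ℕ => ((-Real.log |((f^[n] c : Seg) : ℝ) - (c : ℝ)| / (n : ℝ) : ℝ) : EReal)) atTop
    ∈ Ioo (0 : EReal) ⊤

end LyapunovFibonacci

open LyapunovFibonacci

/-!
The conjugacy `h` turns every question about `f = h ∘ T ∘ h⁻¹` into one about the distance of tent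
orbits to the turning point `0`: the derivatives of `h` at intermediate points cancel in the chain
rule, so that `|(f ^ n)' (h y)| = s ^ n |h' (T ^ n y)| / |h' y|`, where `s` is the slope of the tent
map and `log |h' z|` equals `log |z|` times a positive factor, up to a bounded error, on each side of
`0`. By Cauchy's mean value theorem, `|h z - h 0|` is likewise comparable to a power of `|z|`; this
gives the Lorenz-like singularity.

So the theorem rests on the recurrence of the orbit `crit n = T ^ n 0`. Its kneading sequence says
that `crit (S (k + 1) + j)` and `crit j` lie on the same side of `0` for `1 ≤ j < S k` and on opposite
sides for `j = S k`, where the cutting times `S k` are the Fibonacci numbers (`isFibTent`). Hence the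
tent map expands linearly between these orbits, and the gaps `|crit (S k)|` obey an exact recursion
(`IsFibTent.pow_mul_gap`), by which they are exponentially small in `S k`. Three consequences:

* Any orbit in the closure of the orbit of `0` enters the `13 s ^ (-S k)`-neighbourhood of `0` within
  `S (k + 2)` steps (`IsFibTent.exists_return_of_mem_closure`): it is exponentially close to `0` at
  infinitely many times. It is also infinitely often away from `0`, so that the averages
  `log |(f ^ n)'| / n` oscillate.
* By invariance, that neighbourhood therefore has measure at least `1 / (S (k + 2) + 1)`, while
  `-log |y|` is at least of order `S k` on it. The neighbourhoods shrink to the null set `{0}`; thus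
  `log |y|` is not integrable near `0` (`IsFibTent.lintegral_neg_log_abs`). Near `0` and near
  `T ⁻¹ 0`, this makes the positive and the negative part of `log |f'|` have infinite integral.
* No other return is much closer than the gaps (`IsFibTent.two_mul_gap_le`), so that `|crit n|` is
  bounded below by an exponential (`IsFibTent.le_abs_crit`), and the recurrence is not faster than
  exponential.

Where the orbit of `y` has met `0`, the iterate `T ^ n` has a corner at `y`, and so `f ^ n` is not
differentiable at `h y`.
-/

namespace LyapunovFibonacci

/-! ### Combinatorics of the Fibonacci kneading sequence -/

section Tent

variable {s : ℝ} {hs : s ∈ Ioc (0 : ℝ) 2}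

theorem tent_val (x : Seg) : (tent s hs x : ℝ) = s * (1 - |(x : ℝ)|) - 1 := rfl

theorem continuous_tent : Continuous (tent s hs) := by
  unfold tent
  fun_prop

theorem tent_eq_of_abs_eq {x y : Seg} (h : |(x : ℝ)| = |(y : ℝ)|) :
    tent s hs x = tent s hs y := by
  apply Subtype.ext
  rw [tent_val, tent_val, h]

theorem abs_tent_sub_le (x y : Seg) :
    |(tent s hs x : ℝ) - tent s hs y| ≤ s * |(x : ℝ) - y| := by
  rw [tent_val, tent_val,
    show s * (1 - |(x : ℝ)|) - 1 - (s * (1 - |(y : ℝ)|) - 1) = s * (|(y : ℝ)| - |(x : ℝ)|) by ring,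
    abs_mul, abs_of_pos hs.1, abs_sub_comm (x : ℝ)]
  exact mul_le_mul_of_nonneg_left (abs_abs_sub_abs_le_abs_sub _ _) hs.1.le

theorem abs_tent_sub_eq {x y : Seg} (h : 0 ≤ (x : ℝ) * y) :
    |(tent s hs x : ℝ) - tent s hs y| = s * |(x : ℝ) - y| := by
  rw [tent_val, tent_val,
    show s * (1 - |(x : ℝ)|) - 1 - (s * (1 - |(y : ℝ)|) - 1) = s * (|(y : ℝ)| - |(x : ℝ)|) by ring,
    abs_mul, abs_of_pos hs.1, abs_sub_comm (x : ℝ)]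
  congr 1
  rcases mul_nonneg_iff.1 h with ⟨hx, hy⟩ | ⟨hx, hy⟩
  · rw [abs_of_nonneg hx, abs_of_nonneg hy]
  · rw [abs_of_nonpos hx, abs_of_nonpos hy, ← abs_neg]
    congr 1; ring

theorem abs_iterate_tent_sub_le (n : ℕ) (x y : Seg) :
    |((tent s hs)^[n] x : ℝ) - (tent s hs)^[n] y| ≤ s ^ n * |(x : ℝ) - y| := by
  induction n with
  | zero => simp
  | succ n ih =>
    rw [Function.iterate_succ_apply', Function.iterate_succ_apply']
    refine (abs_tent_sub_le _ _).trans ?_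
    rw [pow_succ', mul_assoc]
    exact mul_le_mul_of_nonneg_left ih hs.1.le

/-- Near any point `y`, whether or not its orbit meets the turning point, the iterates of the tent
map expand the distance to `y` by exactly `s ^ n`: the two orbits stay weakly on the same side of
the turning point. -/
theorem eventually_abs_iterate_tent_sub_eq (n : ℕ) (y : Seg) :
    ∀ᶠ z in 𝓝 y, |((tent s hs)^[n] z : ℝ) - (tent s hs)^[n] y| = s ^ n * |(z : ℝ) - y| := by
  induction n with
  | zero => simp
  | succ n ih =>
    have hc : Continuous (fun z : Seg => ((tent s hs)^[n] z : ℝ) * (tent s hs)^[n] y) :=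
      (continuous_subtype_val.comp (continuous_tent.iterate n)).mul continuous_const
    have hside : ∀ᶠ z in 𝓝 y, 0 ≤ ((tent s hs)^[n] z : ℝ) * (tent s hs)^[n] y := by
      by_cases h0 : ((tent s hs)^[n] y : ℝ) = 0
      · simp [h0]
      · have : 0 < ((tent s hs)^[n] y : ℝ) * (tent s hs)^[n] y := mul_self_pos.2 h0
        exact (hc.continuousAt.eventually (lt_mem_nhds this)).mono fun z hz => le_of_lt hz
    filter_upwards [ih, hside] with z h1 h2
    rw [Function.iterate_succ_apply', Function.iterate_succ_apply', abs_tent_sub_eq h2, h1,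
      pow_succ', mul_assoc]

end Tent

/-- The cutting times `1, 2, 3, 5, 8, …` of the Fibonacci kneading map. -/
abbrev cutTime (k : ℕ) : ℕ := Nat.fib (k + 2)

theorem cutTime_add_two (k : ℕ) : cutTime (k + 2) = cutTime k + cutTime (k + 1) :=
  Nat.fib_add_two

theorem cutTime_pos (k : ℕ) : 1 ≤ cutTime k := Nat.fib_pos.2 (by omega)

theorem cutTime_lt_succ (k : ℕ) : cutTime k < cutTime (k + 1) :=
  Nat.fib_lt_fib_succ (by omega)

theorem cutTime_strictMono : StrictMono cutTime := strictMono_nat_of_lt_succ cutTime_lt_succ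

theorem cutTime_add_le (k i : ℕ) : cutTime k + i ≤ cutTime (k + i) := by
  induction i with
  | zero => simp
  | succ i ih =>
    have : cutTime (k + i) < cutTime (k + (i + 1)) := cutTime_lt_succ (k + i)
    omega

theorem cutTime_succ_le (k : ℕ) : cutTime (k + 1) ≤ 2 * cutTime k := by
  have h1 : cutTime (k + 1) = Nat.fib (k + 1) + cutTime k := Nat.fib_add_two
  have h2 : Nat.fib (k + 1) ≤ cutTime k := Nat.fib_mono (by omega)
  omega

theorem eq_cutTime {S : ℕ → ℕ} (h : IsCuttingTimes (fun k => k - 2) S) (k : ℕ) :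
    S k = cutTime k := by
  have h1 : S 1 = 2 := by
    have := h.2 1 le_rfl
    simp [h.1] at this
    exact this
  have key : ∀ k, S k = cutTime k ∧ S (k + 1) = cutTime (k + 1) := by
    intro k
    induction k with
    | zero => exact ⟨h.1, h1⟩
    | succ k ih =>
      refine ⟨ih.2, ?_⟩
      have := h.2 (k + 2) (by omega)
      simp only [Nat.add_sub_cancel] at this
      rw [cutTime_add_two, ← ih.1, ← ih.2, this]
      have e : k + 2 - 1 = k + 1 := by omega
      rw [e]; ring
  exact (key k).1

theorem Symbol.flip_ne {a : Symbol} (h : a ≠ .turn) : a.flip ≠ a := by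
  cases a <;> simp_all [Symbol.flip]

theorem Symbol.flip_ne_turn {a : Symbol} (h : a ≠ .turn) : a.flip ≠ .turn := by
  cases a <;> simp_all [Symbol.flip]

/-- The recursion of the Fibonacci kneading sequence, written with Fibonacci numbers. -/
structure IsFibSequence (e : ℕ → Symbol) : Prop where
  one : e 1 = .one
  two : e 2 = .zero
  block : ∀ k j, 1 ≤ j → j < cutTime k → e (cutTime (k + 1) + j) = e j
  cut : ∀ k, e (cutTime (k + 2)) = (e (cutTime k)).flip
  three : e 3 = .zero

theorem isFibSequence {S : ℕ → ℕ} {e : ℕ → Symbol} (hS : IsCuttingTimes (fun k => k - 2) S)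
    (he : IsKneadingSequence (fun k => k - 2) S e) : IsFibSequence e := by
  obtain rfl : S = cutTime := funext (eq_cutTime hS)
  obtain ⟨h1, h2⟩ := he
  have e2 := (h2 1 le_rfl).2
  have e3 := (h2 2 (by norm_num)).2
  simp [cutTime, Nat.fib, h1, Symbol.flip] at e2 e3
  refine ⟨h1, e2, fun k j hj hjk => ?_, fun k => ?_, e3⟩
  · have := (h2 (k + 2) (by omega)).1 j hj (by simpa using hjk)
    simpa using this
  · have := (h2 (k + 2) (by omega)).2
    simpa using this

theorem IsFibSequence.cut_ne_turn {e : ℕ → Symbol} (he : IsFibSequence e) (k : ℕ) :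
    e (cutTime k) ≠ .turn := by
  have key : ∀ k, e (cutTime k) ≠ .turn ∧ e (cutTime (k + 1)) ≠ .turn := by
    intro k
    induction k with
    | zero =>
      have h1 : cutTime 0 = 1 := rfl
      have h2 : cutTime (0 + 1) = 2 := rfl
      rw [h1, h2, he.one, he.two]; simp
    | succ k ih => exact ⟨ih.2, by rw [he.cut]; exact Symbol.flip_ne_turn ih.1⟩
  exact (key k).1

theorem IsFibSequence.not_periodic {e : ℕ → Symbol} (he : IsFibSequence e) {p : ℕ} (hp : 1 ≤ p)
    (hper : ∀ i, 1 ≤ i → e (i + p) = e i) : False := by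
  obtain ⟨k, hk⟩ : ∃ k, p < cutTime k := ⟨p + 1, by
    have : p + 1 ≤ cutTime (p + 1) := cutTime_strictMono.le_apply
    omega⟩
  have h0 := cutTime_add_two k
  have h1 := he.block k (cutTime k - p) (by omega) (by omega)
  have h2 := hper (cutTime (k + 1) + (cutTime k - p)) (by omega)
  have h3 := hper (cutTime k - p) (by omega)
  rw [show cutTime (k + 1) + (cutTime k - p) + p = cutTime (k + 2) by omega, he.cut, h1, ← h3,
    show cutTime k - p + p = cutTime k by omega] at h2
  exact Symbol.flip_ne (he.cut_ne_turn k) h2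

/-! ### The orbit of the turning point -/

/-- The position at time `n` of the orbit of the turning point. -/
noncomputable def crit (s : ℝ) (hs : s ∈ Ioc (0 : ℝ) 2) (n : ℕ) : ℝ := ((tent s hs)^[n] origin : Seg)

theorem nhdsGT_origin_neBot : (𝓝[>] origin).NeBot := by
  refine nhdsGT_neBot_of_exists_gt ⟨⟨1, by norm_num⟩, ?_⟩
  rw [← Subtype.coe_lt_coe]
  simp [origin]

/-- The combinatorics of the orbit of the turning point of the Fibonacci tent map. -/
structure IsFibTent (s : ℝ) (hs : s ∈ Ioc (0 : ℝ) 2) : Prop where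
  slope : 8 / 5 < s
  ne_zero : ∀ n, 1 ≤ n → crit s hs n ≠ 0
  same_side : ∀ k j, 1 ≤ j → j < cutTime k → 0 < crit s hs (cutTime (k + 1) + j) * crit s hs j
  opposite : ∀ k, crit s hs (cutTime (k + 2)) * crit s hs (cutTime k) < 0

theorem isFibTent {s : ℝ} {hs : s ∈ Ioc (0 : ℝ) 2}
    (hfib : HasFibonacciRecurrence (tent s hs) origin) : IsFibTent s hs := by
  obtain ⟨-, -, S, e, hS, hknead, hseq⟩ := hfib
  have he := isFibSequence hS hseq
  have hne := nhdsGT_origin_neBot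
  have hlim : ∀ n, Tendsto (fun y : Seg => ((tent s hs)^[n] y : ℝ)) (𝓝[>] origin)
      (𝓝 (crit s hs n)) := fun n =>
    ((continuous_subtype_val.comp (continuous_tent.iterate n)).tendsto origin).mono_left
      nhdsWithin_le_nhds
  -- If the turning point had period `p`, then so would the kneading invariant: the tent map is
  -- even, and `|T ^ p y|` decreases to the turning point along with `y`.
  have hcrit : ∀ p, 1 ≤ p → crit s hs p ≠ 0 := by
    intro p hp h0
    refine he.not_periodic hp fun i hi => ?_
    let φ : Seg → Seg := fun y => ⟨|((tent s hs)^[p] y : ℝ)|, by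
      have := ((tent s hs)^[p] y).2
      exact ⟨by linarith [abs_nonneg ((tent s hs)^[p] y : ℝ)], abs_le.2 this⟩⟩
    have hφc : Continuous φ := by
      have := (continuous_tent (hs := hs)).iterate p
      refine Continuous.subtype_mk ?_ _
      exact (continuous_subtype_val.comp this).abs
    have hφ0 : φ origin = origin := Subtype.ext (by
      change |crit s hs p| = 0
      rw [h0, abs_zero])
    have hφ : Tendsto φ (𝓝[>] origin) (𝓝[>] origin) := by
      refine tendsto_nhdsWithin_iff.2 ⟨?_, ?_⟩
      · have := hφc.tendsto origin
        rw [hφ0] at this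
        exact this.mono_left nhdsWithin_le_nhds
      · filter_upwards [nhdsWithin_le_nhds (eventually_abs_iterate_tent_sub_eq (hs := hs) p origin),
          self_mem_nhdsWithin] with y hy hy0
        have hy0' : (0 : ℝ) < y := hy0
        have h0' : ((tent s hs)^[p] origin : ℝ) = 0 := h0
        rw [h0', sub_zero] at hy
        change (0 : ℝ) < |((tent s hs)^[p] y : ℝ)|
        rw [hy]
        have h3 : (origin : ℝ) = 0 := rfl
        rw [h3, sub_zero, abs_of_pos hy0']
        exact mul_pos (pow_pos hs.1 _) hy0'
    obtain ⟨y, hy1, hy2⟩ := ((hφ.eventually (hknead i hi)).and (hknead (i + p) (by omega))).exists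
    rw [← hy1, ← hy2]
    obtain ⟨i, rfl⟩ : ∃ i', i = i' + 1 := ⟨i - 1, by omega⟩
    have : (tent s hs)^[i + 1 + p] y = (tent s hs)^[i + 1] (φ y) := by
      rw [Function.iterate_add_apply, Function.iterate_succ_apply, Function.iterate_succ_apply]
      congr 1
      exact tent_eq_of_abs_eq (abs_abs _).symm
    simp only [itinerary, this]
  have hpos : ∀ j, 1 ≤ j → 0 < crit s hs j → e j = .one := by
    intro j hj h
    obtain ⟨y, hy1, hy2⟩ := ((hknead j hj).and ((hlim j).eventually (lt_mem_nhds h))).exists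
    have h2 : origin < (tent s hs)^[j] y := hy2
    rw [← hy1, itinerary, if_neg h2.not_gt, if_pos h2]
  have hneg : ∀ j, 1 ≤ j → crit s hs j < 0 → e j = .zero := by
    intro j hj h
    obtain ⟨y, hy1, hy2⟩ := ((hknead j hj).and ((hlim j).eventually (gt_mem_nhds h))).exists
    have h2 : (tent s hs)^[j] y < origin := hy2
    rw [← hy1, itinerary, if_pos h2]
  have hpos' : ∀ j, 1 ≤ j → e j = .one → 0 < crit s hs j := by
    intro j hj h
    by_contra hn
    have := hneg j hj (lt_of_le_of_ne (not_lt.1 hn) (hcrit j hj))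
    rw [h] at this; cases this
  have hneg' : ∀ j, 1 ≤ j → e j = .zero → crit s hs j < 0 := by
    intro j hj h
    by_contra hn
    have := hpos j hj (lt_of_le_of_ne (not_lt.1 hn) (hcrit j hj).symm)
    rw [h] at this; cases this
  refine ⟨?_, hcrit, fun k j hj hjk => ?_, fun k => ?_⟩
  · have h1 := hpos' 1 le_rfl he.one
    have h3 := hneg' 3 (by norm_num) he.three
    have h0 : ((origin : Seg) : ℝ) = 0 := rfl
    have e1 : crit s hs 1 = s - 1 := by simp [crit, tent_val, h0]
    have e2 : crit s hs 2 = -(s - 1) ^ 2 := by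
      have : crit s hs 2 = s * (1 - |crit s hs 1|) - 1 := rfl
      rw [this, abs_of_pos h1, e1]; ring
    have e3 : crit s hs 3 = s * (1 - (s - 1) ^ 2) - 1 := by
      have : crit s hs 3 = s * (1 - |crit s hs 2|) - 1 := rfl
      rw [this, e2, abs_neg, abs_of_nonneg (sq_nonneg _)]
    rw [e1] at h1
    rw [e3] at h3
    have h4 : 0 < (s - 1) * (s ^ 2 - s - 1) := by nlinarith
    have h5 := (mul_pos_iff_of_pos_left h1).1 h4
    nlinarith
  · have hb := he.block k j hj hjk
    rcases lt_or_gt_of_ne (hcrit j hj) with h | h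
    · exact mul_pos_of_neg_of_neg (hneg' _ (by omega) (hb.trans (hneg j hj h))) h
    · exact mul_pos (hpos' _ (by omega) (hb.trans (hpos j hj h))) h
  · have hb := he.cut k
    have h1 := cutTime_pos k
    have h2 := cutTime_pos (k + 2)
    rcases lt_or_gt_of_ne (hcrit _ h1) with h | h
    · rw [hneg _ h1 h] at hb
      exact mul_neg_of_pos_of_neg (hpos' _ h2 hb) h
    · rw [hpos _ h1 h] at hb
      exact mul_neg_of_neg_of_pos (hneg' _ h2 hb) h

/-! ### The closest returns of the turning point -/

/-- The distance to the turning point of its return at the cutting time number `k`. -/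
noncomputable def gap (s : ℝ) (hs : s ∈ Ioc (0 : ℝ) 2) (k : ℕ) : ℝ := |crit s hs (cutTime k)|

section Tent

variable {s : ℝ} {hs : s ∈ Ioc (0 : ℝ) 2}

theorem crit_zero : crit s hs 0 = 0 := rfl

theorem iterate_crit (i n : ℕ) :
    ((tent s hs)^[i] ((tent s hs)^[n] origin) : ℝ) = crit s hs (i + n) := by
  rw [← Function.iterate_add_apply]; rfl

theorem abs_crit_le_one (n : ℕ) : |crit s hs n| ≤ 1 := abs_le.2 ((tent s hs)^[n] origin).2

namespace IsFibTent

variable (H : IsFibTent s hs)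
include H

theorem one_lt : 1 < s := by linarith [H.slope]

theorem gap_pos (k : ℕ) : 0 < gap s hs k := abs_pos.2 (H.ne_zero _ (cutTime_pos k))

/-- Up to time `cutTime k`, the orbit of the return at time `cutTime (k + 1)` shadows the orbit of
the turning point with linear expansion, since no iterate separates them by the turning point. -/
theorem abs_crit_add_sub (k j : ℕ) (hj : j ≤ cutTime k) :
    |crit s hs (cutTime (k + 1) + j) - crit s hs j| = s ^ j * gap s hs (k + 1) := by
  induction j with
  | zero => simp [crit_zero, gap]
  | succ j ih =>
    have h1 : crit s hs (cutTime (k + 1) + (j + 1)) =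
        tent s hs ((tent s hs)^[cutTime (k + 1) + j] origin) := by
      rw [← Function.iterate_succ_apply' (tent s hs)]; rfl
    have h2 : crit s hs (j + 1) = tent s hs ((tent s hs)^[j] origin) := by
      rw [← Function.iterate_succ_apply' (tent s hs)]; rfl
    rw [h1, h2, abs_tent_sub_eq, pow_succ', mul_assoc, ← ih (by omega)]
    · rfl
    · rcases Nat.eq_zero_or_pos j with rfl | hj0
      · have h0 : (((tent s hs)^[0] origin : Seg) : ℝ) = 0 := rfl
        rw [h0, mul_zero]
      · exact (H.same_side k j hj0 (by omega)).le

theorem pow_mul_gap (k : ℕ) :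
    s ^ cutTime k * gap s hs (k + 1) = gap s hs (k + 2) + gap s hs k := by
  rw [← H.abs_crit_add_sub k _ le_rfl, ← Nat.add_comm (cutTime k), ← cutTime_add_two]
  unfold gap
  rcases mul_neg_iff.1 (H.opposite k) with ⟨h1, h2⟩ | ⟨h1, h2⟩
  · rw [abs_of_pos h1, abs_of_neg h2, abs_of_pos (by linarith)]; ring
  · rw [abs_of_neg h1, abs_of_pos h2, abs_of_neg (by linarith)]; ring

theorem gap_succ_le (k : ℕ) : gap s hs (k + 1) ≤ 2 * (s⁻¹) ^ cutTime k := by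
  have h1 := H.pow_mul_gap k
  have h2 : gap s hs (k + 2) ≤ 1 := abs_crit_le_one _
  have h3 : gap s hs k ≤ 1 := abs_crit_le_one _
  have hp : 0 < s ^ cutTime k := pow_pos hs.1 _
  rw [inv_pow, ← div_eq_mul_inv, le_div_iff₀ hp]
  linarith

theorem inv_pow_le {m n : ℕ} (h : m ≤ n) : (s⁻¹) ^ n ≤ (s⁻¹) ^ m :=
  pow_le_pow_of_le_one (inv_nonneg.2 hs.1.le) (inv_le_one_of_one_le₀ H.one_lt.le) h

/-- Any time `m` up to a cutting time is followed, within `cutTime (k + 2)` steps, by a return to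
within a constant multiple of `s ^ (-cutTime k)`. The factor `13 - 11 (5/8) ^ i` bounds the partial
sums of the errors made in replacing `cutTime (k + 2 + i) + n` by `n`. -/
theorem exists_return_le_cutTime (k i : ℕ) : ∀ m ≤ cutTime (k + 1 + i), ∃ n, 1 ≤ n ∧ m ≤ n ∧
    n ≤ m + cutTime (k + 2) ∧ n ≤ cutTime (k + 1 + i) ∧
    |crit s hs n| ≤ (s⁻¹) ^ cutTime k * (13 - 11 * (5 / 8) ^ i) := by
  have hpos : 0 < (s⁻¹) ^ cutTime k := pow_pos (inv_pos.2 hs.1) _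
  have hmono := cutTime_strictMono.monotone
  have hdec : ∀ {a b : ℕ}, a ≤ b → ((5 : ℝ) / 8) ^ b ≤ (5 / 8) ^ a := fun hab =>
    pow_le_pow_of_le_one (by norm_num) (by norm_num) hab
  induction i using Nat.strong_induction_on with
  | _ i ih =>
  match i, ih with
  | 0, _ =>
    intro m hm
    refine ⟨cutTime (k + 1), cutTime_pos _, hm, ?_, le_rfl, ?_⟩
    · have : cutTime (k + 1) ≤ cutTime (k + 2) := hmono (by omega)
      omega
    · have := H.gap_succ_le k
      unfold gap at this
      refine this.trans (le_of_eq ?_)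
      ring
  | 1, ih =>
    intro m hm
    rcases le_or_gt m (cutTime (k + 1)) with h | h
    · obtain ⟨n, h1, h2, h3, h4, h5⟩ := ih 0 (by omega) m h
      have : cutTime (k + 1) ≤ cutTime (k + 1 + 1) := hmono (by omega)
      refine ⟨n, h1, h2, h3, h4.trans this, h5.trans ?_⟩
      refine mul_le_mul_of_nonneg_left ?_ hpos.le
      norm_num
    · refine ⟨cutTime (k + 2), cutTime_pos _, hm, by omega, le_rfl, ?_⟩
      have h1 := H.gap_succ_le (k + 1)
      have h2 := H.inv_pow_le (cutTime_lt_succ k).le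
      unfold gap at h1
      refine h1.trans ?_
      rw [pow_one]
      linarith
  | i + 2, ih =>
    intro m hm
    rcases le_or_gt m (cutTime (k + 1 + (i + 1))) with h | h
    · obtain ⟨n, h1, h2, h3, h4, h5⟩ := ih (i + 1) (by omega) m h
      have : cutTime (k + 1 + (i + 1)) ≤ cutTime (k + 1 + (i + 2)) := hmono (by omega)
      refine ⟨n, h1, h2, h3, h4.trans this, h5.trans ?_⟩
      exact mul_le_mul_of_nonneg_left (by linarith [hdec (by omega : i + 1 ≤ i + 2)]) hpos.le
    · have hadd : cutTime (k + 1 + (i + 2)) = cutTime (k + 1 + i) + cutTime (k + 1 + i + 1) :=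
        cutTime_add_two (k + 1 + i)
      have h' : cutTime (k + 1 + i + 1) < m := h
      obtain ⟨n, h1, h2, h3, h4, h5⟩ := ih i (by omega) (m - cutTime (k + 1 + i + 1)) (by omega)
      refine ⟨cutTime (k + 1 + i + 1) + n, by omega, by omega, by omega, by omega, ?_⟩
      have e1 := H.abs_crit_add_sub (k + 1 + i) n h4
      have e2 : s ^ n * gap s hs (k + 1 + i + 1) ≤
          s ^ cutTime (k + 1 + i) * gap s hs (k + 1 + i + 1) :=
        mul_le_mul_of_nonneg_right (pow_le_pow_right₀ H.one_lt.le h4) (H.gap_pos _).le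
      rw [H.pow_mul_gap] at e2
      have e3 : gap s hs (k + 1 + i + 2) ≤ 2 * (s⁻¹) ^ cutTime (k + i) :=
        (H.gap_succ_le _).trans
          (mul_le_mul_of_nonneg_left (H.inv_pow_le (hmono (by omega))) (by norm_num))
      have e4 : gap s hs (k + 1 + i) ≤ 2 * (s⁻¹) ^ cutTime (k + i) := by
        rw [show k + 1 + i = k + i + 1 by ring]
        exact H.gap_succ_le _
      have e5 : (s⁻¹) ^ cutTime (k + i) ≤ (s⁻¹) ^ cutTime k * (5 / 8) ^ i := by
        refine (H.inv_pow_le (cutTime_add_le k i)).trans ?_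
        rw [pow_add]
        refine mul_le_mul_of_nonneg_left (pow_le_pow_left₀ (inv_nonneg.2 hs.1.le) ?_ _) hpos.le
        rw [inv_le_comm₀ hs.1 (by norm_num)]
        linarith [H.slope]
      have e6 := abs_sub_abs_le_abs_sub (crit s hs (cutTime (k + 1 + i + 1) + n)) (crit s hs n)
      have e7 : 0 < (s⁻¹) ^ cutTime k * (5 / 8) ^ i := by positivity
      rw [pow_add]
      nlinarith

/-- Along the orbit of the turning point, the returns close to it have bounded gaps. -/
theorem exists_return (k m : ℕ) : ∃ n ≤ cutTime (k + 2),
    |crit s hs (m + n)| ≤ 13 * (s⁻¹) ^ cutTime k := by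
  have hm : m ≤ cutTime (k + 1 + m) := by
    have : k + 1 + m ≤ cutTime (k + 1 + m) := cutTime_strictMono.le_apply
    omega
  obtain ⟨n, -, h2, h3, -, h5⟩ := H.exists_return_le_cutTime k m m hm
  refine ⟨n - m, by omega, ?_⟩
  rw [Nat.add_sub_cancel' h2]
  refine h5.trans ?_
  have : 0 < (s⁻¹) ^ cutTime k := pow_pos (inv_pos.2 hs.1) _
  have h6 : (0 : ℝ) < (5 / 8) ^ m := by positivity
  nlinarith

/-- Every orbit in the closure of the orbit of the turning point comes back close to the turning
point, with a uniform bound on the waiting time. -/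
theorem exists_return_of_mem_closure (k : ℕ) {y : Seg}
    (hy : y ∈ closure (orbit (tent s hs) origin)) :
    ∃ n ≤ cutTime (k + 2), |((tent s hs)^[n] y : ℝ)| ≤ 13 * (s⁻¹) ^ cutTime k := by
  have hcl : IsClosed (⋃ n ∈ Iic (cutTime (k + 2)),
      {y : Seg | |((tent s hs)^[n] y : ℝ)| ≤ 13 * (s⁻¹) ^ cutTime k}) := by
    refine (finite_Iic _).isClosed_biUnion fun n _ => ?_
    exact isClosed_le (continuous_subtype_val.comp (continuous_tent.iterate n)).abs continuous_const
  have hsub : orbit (tent s hs) origin ⊆ ⋃ n ∈ Iic (cutTime (k + 2)),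
      {y : Seg | |((tent s hs)^[n] y : ℝ)| ≤ 13 * (s⁻¹) ^ cutTime k} := by
    rintro _ ⟨m, rfl⟩
    obtain ⟨n, hn, h⟩ := H.exists_return k m
    refine mem_biUnion (x := n) hn ?_
    rw [mem_ofPred_eq, iterate_crit, add_comm]
    exact h
  simpa using closure_minimal hsub hcl hy

/-! ### Lower bounds for the returns of the turning point -/

theorem gap_antitone : Antitone (gap s hs) := by
  refine antitone_nat_of_succ_le fun k => ?_
  have hs1 := H.slope
  match k with
  | 0 =>
    have e : ((origin : Seg) : ℝ) = 0 := rfl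
    have h1 : crit s hs 1 = s - 1 := by simp [crit, tent_val, e]
    have h2 : crit s hs 2 = -(s - 1) ^ 2 := by
      have : crit s hs 2 = s * (1 - |crit s hs 1|) - 1 := rfl
      rw [this, h1, abs_of_pos (by linarith)]; ring
    change |crit s hs 2| ≤ |crit s hs 1|
    rw [h1, h2, abs_neg, abs_of_nonneg (sq_nonneg _), abs_of_pos (by linarith)]
    have := hs.2
    nlinarith
  | k + 1 =>
    -- Otherwise the gaps would grow geometrically from there on, but they are at most `1`.
    by_contra! hlt
    have hgrow : ∀ i, gap s hs (k + 1 + i) < gap s hs (k + 1 + (i + 1)) ∧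
        (3 / 2) ^ i * gap s hs (k + 1) ≤ gap s hs (k + 1 + (i + 1)) := by
      intro i
      induction i with
      | zero => exact ⟨hlt, by simpa using hlt.le⟩
      | succ i ih =>
        obtain ⟨ih1, ih2⟩ := ih
        have hr : s ^ cutTime (k + 1 + i) * gap s hs (k + 1 + (i + 1)) =
          gap s hs (k + 1 + (i + 1) + 1) + gap s hs (k + 1 + i) := H.pow_mul_gap (k + 1 + i)
        have hp : (5 : ℝ) / 2 ≤ s ^ cutTime (k + 1 + i) := by
          have h2 : 2 ≤ cutTime (k + 1 + i) := cutTime_strictMono.monotone (by omega : 1 ≤ k + 1 + i)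
          calc (5 : ℝ) / 2 ≤ s ^ 2 := by nlinarith
            _ ≤ _ := pow_le_pow_right₀ H.one_lt.le h2
        have hpos := H.gap_pos (k + 1 + (i + 1))
        have h3 : 3 / 2 * gap s hs (k + 1 + (i + 1)) < gap s hs (k + 1 + (i + 1) + 1) := by
          nlinarith
        refine ⟨lt_of_le_of_lt (by linarith) h3, le_trans ?_ h3.le⟩
        rw [pow_succ]
        linarith
    obtain ⟨i, hi⟩ := pow_unbounded_of_one_lt (1 / gap s hs (k + 1)) (by norm_num : (1 : ℝ) < 3 / 2)
    rw [div_lt_iff₀ (H.gap_pos _)] at hi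
    have h1 : gap s hs (k + 1 + (i + 1)) ≤ 1 := abs_crit_le_one _
    linarith [(hgrow i).2]

theorem gap_succ_mul_le (k : ℕ) : s ^ cutTime k * gap s hs (k + 1) ≤ 2 * gap s hs k := by
  rw [H.pow_mul_gap]
  linarith [H.gap_antitone (by omega : k ≤ k + 2)]

theorem le_gap (k : ℕ) : (s - 1) * (s⁻¹) ^ cutTime (k + 1) ≤ gap s hs k := by
  have h1 := H.one_lt
  induction k with
  | zero =>
    have e : ((origin : Seg) : ℝ) = 0 := rfl
    have h1' : crit s hs 1 = s - 1 := by simp [crit, tent_val, e]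
    have h0 : gap s hs 0 = s - 1 := by
      change |crit s hs 1| = s - 1
      rw [h1', abs_of_pos (by linarith)]
    rw [h0]
    refine mul_le_of_le_one_right (by linarith) ?_
    exact pow_le_one₀ (inv_nonneg.2 hs.1.le) (inv_le_one_of_one_le₀ h1.le)
  | succ k ih =>
    have h2 : gap s hs k ≤ s ^ cutTime k * gap s hs (k + 1) := by
      rw [H.pow_mul_gap]; linarith [H.gap_pos (k + 2)]
    have hp : 0 < s ^ cutTime k := pow_pos hs.1 _
    have h3 : cutTime (k + 1 + 1) = cutTime k + cutTime (k + 1) := cutTime_add_two k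
    rw [h3, pow_add, inv_pow s (cutTime k)]
    have h4 := ih.trans h2
    calc (s - 1) * ((s ^ cutTime k)⁻¹ * s⁻¹ ^ cutTime (k + 1))
        = (s ^ cutTime k)⁻¹ * ((s - 1) * s⁻¹ ^ cutTime (k + 1)) := by ring
      _ ≤ (s ^ cutTime k)⁻¹ * (s ^ cutTime k * gap s hs (k + 1)) :=
          mul_le_mul_of_nonneg_left h4 (inv_nonneg.2 hp.le)
      _ = gap s hs (k + 1) := by field_simp

/-- Before the time `cutTime (k + 1)`, the turning point is not approached more closely than twice
the gap number `k + 3`. -/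
theorem two_mul_gap_le (k : ℕ) :
    ∀ n, 1 ≤ n → n < cutTime (k + 1) → 2 * gap s hs (k + 3) ≤ |crit s hs n| := by
  have hs1 := H.slope
  have hpw : ∀ m, 3 ≤ m → (4 : ℝ) ≤ s ^ m := fun m hm => by
    calc (4 : ℝ) ≤ (8 / 5) ^ 3 := by norm_num
      _ ≤ s ^ 3 := by gcongr
      _ ≤ s ^ m := pow_le_pow_right₀ H.one_lt.le hm
  -- A cutting time itself is dealt with by the decay of the gaps.
  have hcut : ∀ k, 2 * gap s hs (k + 3) ≤ gap s hs (k + 1) := fun k => by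
    have h1 := H.gap_succ_mul_le (k + 2)
    have h2 := H.gap_antitone (by omega : k + 1 ≤ k + 2)
    have h3 := hpw (cutTime (k + 2)) (cutTime_strictMono.monotone (by omega : 2 ≤ k + 2))
    have h4 := H.gap_pos (k + 3)
    have h5 : gap s hs (k + 2 + 1) = gap s hs (k + 3) := rfl
    rw [h5] at h1
    nlinarith
  induction k using Nat.strong_induction_on with
  | _ k ih =>
  match k, ih with
  | 0, _ =>
    intro n h1 h2
    have h2' : n < 2 := h2
    obtain rfl : n = 1 := by omega
    exact (hcut 0).trans (H.gap_antitone (by omega : 0 ≤ 1))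
  | 1, _ =>
    intro n h1 h2
    have h2' : n < 3 := h2
    have h3 : n = 1 ∨ n = 2 := by omega
    rcases h3 with rfl | rfl
    · exact (hcut 1).trans (H.gap_antitone (by omega : 0 ≤ 2))
    · exact (hcut 1).trans (H.gap_antitone (by omega : 1 ≤ 2))
  | k + 2, ih =>
    intro n h1 h2
    rcases lt_trichotomy n (cutTime (k + 2)) with h | h | h
    · refine le_trans ?_ (ih (k + 1) (by omega) n h1 h)
      linarith [H.gap_antitone (by omega : k + 1 + 3 ≤ k + 2 + 3)]
    · rw [h]
      exact (hcut (k + 2)).trans (H.gap_antitone (by omega : k + 2 ≤ k + 3))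
    · -- Follow the point for `i` steps, up to the next cutting time: it lands very close to the
      -- turning point, while the turning point itself is still far away from it.
      have hadd : cutTime (k + 2 + 1) = cutTime (k + 1) + cutTime (k + 2) := cutTime_add_two (k + 1)
      obtain ⟨i, hi⟩ : ∃ i, i + n = cutTime (k + 2 + 1) := ⟨cutTime (k + 2 + 1) - n, by omega⟩
      have e1 := ih k (by omega) i (by omega) (by omega)
      have e2 := abs_iterate_tent_sub_le (hs := hs) i ((tent s hs)^[n] origin) origin
      have e0 : ((origin : Seg) : ℝ) = 0 := rfl
      rw [iterate_crit, hi, e0, sub_zero] at e2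
      have e3 : |crit s hs i| - gap s hs (k + 3) ≤ s ^ i * |crit s hs n| := by
        refine le_trans ?_ e2
        rw [abs_sub_comm]
        exact abs_sub_abs_le_abs_sub _ _
      have e4 : s ^ i * |crit s hs n| ≤ s ^ cutTime (k + 1) * |crit s hs n| :=
        mul_le_mul_of_nonneg_right (pow_le_pow_right₀ H.one_lt.le (by omega)) (abs_nonneg _)
      have e5 : gap s hs (k + 3) ≤ s ^ cutTime (k + 1) * |crit s hs n| := by linarith
      have e6 : s ^ cutTime (k + 3) * gap s hs (k + 4) ≤ 2 * gap s hs (k + 3) :=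
        H.gap_succ_mul_le (k + 3)
      have e7 : s ^ cutTime (k + 4) * gap s hs (k + 5) ≤ 2 * gap s hs (k + 4) :=
        H.gap_succ_mul_le (k + 4)
      have p3 := H.gap_pos (k + 3)
      have p4 := H.gap_pos (k + 4)
      have p5 := H.gap_pos (k + 5)
      have hm := cutTime_strictMono.monotone
      have q3 := hpw (cutTime (k + 3)) (hm (by omega : 2 ≤ k + 3))
      have q4 : s ^ cutTime (k + 1) * 4 ≤ s ^ cutTime (k + 4) := by
        have a1 : cutTime (k + 4) = cutTime (k + 2) + cutTime (k + 3) := cutTime_add_two (k + 2)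
        have a2 : cutTime (k + 1) ≤ cutTime (k + 2) := hm (by omega)
        have a3 : 3 ≤ cutTime (k + 3) := hm (by omega : 2 ≤ k + 3)
        have a4 := hpw (cutTime (k + 4) - cutTime (k + 1)) (by omega)
        have a5 : s ^ cutTime (k + 4) = s ^ cutTime (k + 1) * s ^ (cutTime (k + 4) - cutTime (k + 1)) := by
          rw [← pow_add]; congr 1; omega
        rw [a5]
        exact mul_le_mul_of_nonneg_left a4 (pow_pos hs.1 _).le
      have r1 : 2 * gap s hs (k + 4) ≤ gap s hs (k + 3) := by nlinarith
      have r2 : s ^ cutTime (k + 1) * (2 * gap s hs (k + 5)) ≤ gap s hs (k + 4) := by nlinarith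
      have hp : 0 < s ^ cutTime (k + 1) := pow_pos hs.1 _
      exact le_of_mul_le_mul_left (r2.trans (by linarith)) hp

/-- The orbit of the turning point approaches it at most exponentially fast. -/
theorem le_abs_crit {n : ℕ} (hn : 1 ≤ n) : (s - 1) * (s⁻¹) ^ (16 * n) ≤ |crit s hs n| := by
  obtain ⟨k, hk1, hk2⟩ : ∃ k, cutTime k ≤ n ∧ n < cutTime (k + 1) := by
    have hex : ∃ k, n < cutTime k := ⟨n + 1, by
      have : n + 1 ≤ cutTime (n + 1) := cutTime_strictMono.le_apply
      omega⟩
    classical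
    have h0 : Nat.find hex ≠ 0 := fun h => by
      have := Nat.find_spec hex
      rw [h] at this
      have h1 : cutTime 0 = 1 := rfl
      omega
    refine ⟨Nat.find hex - 1, ?_, ?_⟩
    · have := Nat.find_min hex (m := Nat.find hex - 1) (by omega)
      omega
    · rw [Nat.sub_add_cancel (by omega)]
      exact Nat.find_spec hex
  have h1 := H.two_mul_gap_le k n hn hk2
  have h2 := H.le_gap (k + 3)
  have h3 := H.gap_pos (k + 3)
  have h4 : cutTime (k + 3 + 1) ≤ 16 * n := by
    have a1 := cutTime_succ_le k
    have a2 := cutTime_succ_le (k + 1)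
    have a3 := cutTime_succ_le (k + 2)
    have a4 := cutTime_succ_le (k + 3)
    simp only [add_assoc, Nat.reduceAdd] at *
    omega
  have h5 := mul_le_mul_of_nonneg_left (H.inv_pow_le h4) (by linarith [H.one_lt] : 0 ≤ s - 1)
  linarith

end IsFibTent

end Tent

/-! ### Closeness to the turning point along orbits and for the invariant measure -/

theorem log_mul_inv_pow {a s : ℝ} (ha : 0 < a) (hs : 0 < s) (n : ℕ) :
    Real.log (a * (s⁻¹) ^ n) = Real.log a - n * Real.log s := by
  rw [Real.log_mul ha.ne' (pow_pos (inv_pos.2 hs) n).ne', Real.log_pow, Real.log_inv]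
  ring

section Tent

variable {s : ℝ} {hs : s ∈ Ioc (0 : ℝ) 2}

namespace IsFibTent

variable (H : IsFibTent s hs)
include H

theorem log_slope_pos : 0 < Real.log s := Real.log_pos H.one_lt

theorem tendsto_inv_pow_cutTime : Tendsto (fun k => (s⁻¹) ^ cutTime k) atTop (𝓝 0) :=
  (tendsto_pow_atTop_nhds_zero_of_lt_one (inv_nonneg.2 hs.1.le) (inv_lt_one_of_one_lt₀ H.one_lt)).comp
    cutTime_strictMono.tendsto_atTop

theorem frequently_log_crit_le :
    ∃ᶠ n : ℕ in atTop, Real.log |crit s hs n| ≤ Real.log 2 - n * (Real.log s / 2) := by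
  have ht : Tendsto (fun k => cutTime (k + 1)) atTop atTop :=
    cutTime_strictMono.tendsto_atTop.comp (tendsto_add_atTop_nat 1)
  refine ht.frequently (Frequently.of_forall fun k => ?_)
  refine (Real.log_le_log (H.gap_pos (k + 1)) (H.gap_succ_le k)).trans ?_
  rw [log_mul_inv_pow (by norm_num) hs.1]
  have h1 : (cutTime (k + 1) : ℝ) ≤ 2 * cutTime k := by exact_mod_cast cutTime_succ_le k
  nlinarith [H.log_slope_pos]

/-- Every orbit in the closure of the orbit of the turning point comes exponentially close to that
point, infinitely often. -/
theorem frequently_log_iterate_le {y : Seg} (hy : y ∈ closure (orbit (tent s hs) origin))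
    (h0 : ∀ n, ((tent s hs)^[n] y : ℝ) ≠ 0) :
    ∃ᶠ n : ℕ in atTop,
      Real.log |((tent s hs)^[n] y : ℝ)| ≤ Real.log 13 - n * (Real.log s / 3) := by
  rw [frequently_atTop]
  intro N
  -- The finitely many points before time `N` are not close enough, for `k` large.
  have hk : ∀ᶠ k in atTop, ∀ n ∈ Finset.range N,
      13 * (s⁻¹) ^ cutTime k < |((tent s hs)^[n] y : ℝ)| := by
    rw [Filter.eventually_all_finset]
    intro n _
    have := H.tendsto_inv_pow_cutTime.const_mul 13
    rw [mul_zero] at this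
    exact this.eventually (gt_mem_nhds (abs_pos.2 (h0 n)))
  obtain ⟨k, hk⟩ := hk.exists
  obtain ⟨n, hn, hle⟩ := H.exists_return_of_mem_closure k hy
  refine ⟨n, ?_, ?_⟩
  · by_contra hlt
    exact absurd hle (not_le.2 (hk n (Finset.mem_range.2 (not_le.1 hlt))))
  · refine (Real.log_le_log (abs_pos.2 (h0 n)) hle).trans ?_
    rw [log_mul_inv_pow (by norm_num) hs.1]
    have h1 : n ≤ 3 * cutTime k := by
      have a1 := cutTime_succ_le k
      have a2 := cutTime_add_two k
      omega
    have h2 : (n : ℝ) ≤ 3 * cutTime k := by exact_mod_cast h1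
    nlinarith [H.log_slope_pos]

theorem frequently_le_abs_iterate (y : Seg) :
    ∃ᶠ n : ℕ in atTop, 1 / 10 ≤ |((tent s hs)^[n] y : ℝ)| := by
  rw [frequently_atTop]
  intro N
  rcases le_or_gt (1 / 10) |((tent s hs)^[N] y : ℝ)| with h | h
  · exact ⟨N, le_rfl, h⟩
  · refine ⟨N + 1, by omega, ?_⟩
    rw [Function.iterate_succ_apply', tent_val]
    have := H.slope
    rw [abs_of_pos (by nlinarith)]
    nlinarith

section Measure

variable {μ : Measure Seg} [IsProbabilityMeasure μ] (hμ : MeasurePreserving (tent s hs) μ μ)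
include hμ

/-- By Poincaré recurrence, since the turning point is not periodic. -/
theorem measure_origin : μ {origin} = 0 := by
  by_contra hne
  obtain ⟨x, hx, m, hm, hxm⟩ := hμ.conservative.exists_mem_iterate_mem
    (measurableSet_singleton origin).nullMeasurableSet hne
  rw [mem_singleton_iff] at hx hxm
  rw [hx] at hxm
  refine H.ne_zero m (by omega) ?_
  rw [crit, hxm]; rfl

theorem one_le_mul_measure (hsupp : μ (closure (orbit (tent s hs) origin))ᶜ = 0) (k : ℕ) :
    1 ≤ (cutTime (k + 2) + 1 : ℕ) * μ {y : Seg | |(y : ℝ)| ≤ 13 * (s⁻¹) ^ cutTime k} := by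
  set U : Set Seg := {y : Seg | |(y : ℝ)| ≤ 13 * (s⁻¹) ^ cutTime k}
  have hU : MeasurableSet U :=
    (isClosed_le continuous_subtype_val.abs continuous_const).measurableSet
  have hX : μ (closure (orbit (tent s hs) origin)) = 1 :=
    (prob_compl_eq_zero_iff isClosed_closure.measurableSet).1 hsupp
  calc (1 : ENNReal) = μ (closure (orbit (tent s hs) origin)) := hX.symm
    _ ≤ μ (⋃ n ∈ Finset.range (cutTime (k + 2) + 1), (tent s hs)^[n] ⁻¹' U) := by
      refine measure_mono fun y hy => ?_
      obtain ⟨n, hn, h⟩ := H.exists_return_of_mem_closure k hy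
      exact mem_biUnion (x := n) (by simpa using Nat.lt_succ_of_le hn) h
    _ ≤ ∑ n ∈ Finset.range (cutTime (k + 2) + 1), μ ((tent s hs)^[n] ⁻¹' U) :=
      measure_biUnion_finset_le _ _
    _ = ∑ n ∈ Finset.range (cutTime (k + 2) + 1), μ U :=
      Finset.sum_congr rfl fun n _ => (hμ.iterate n).measure_preimage hU.nullMeasurableSet
    _ = _ := by simp

/-- The logarithm of the distance to the turning point is not integrable near that point: the set
where it is at most about `-cutTime k` has measure at least of the order `1 / cutTime k`, so that
the integrals over these sets, which shrink to a null set, do not tend to `0`. -/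
theorem lintegral_neg_log_abs (hsupp : μ (closure (orbit (tent s hs) origin))ᶜ = 0) {δ : ℝ}
    (hδ : 0 < δ) :
    ∫⁻ y in {y : Seg | |(y : ℝ)| < δ}, ENNReal.ofReal (-Real.log |(y : ℝ)|) ∂μ = ⊤ := by
  by_contra hfin
  have hls := H.log_slope_pos
  set F : Seg → ENNReal := fun y => ENNReal.ofReal (-Real.log |(y : ℝ)|)
  set U : ℕ → Set Seg := fun k => {y : Seg | |(y : ℝ)| ≤ 13 * (s⁻¹) ^ cutTime k}
  have hUm : ∀ k, MeasurableSet (U k) := fun k =>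
    (isClosed_le continuous_subtype_val.abs continuous_const).measurableSet
  have hVm : MeasurableSet {y : Seg | |(y : ℝ)| < δ} :=
    (isOpen_lt continuous_subtype_val.abs continuous_const).measurableSet
  have hlim : Tendsto (fun k => 13 * (s⁻¹) ^ cutTime k) atTop (𝓝 0) := by
    simpa using H.tendsto_inv_pow_cutTime.const_mul 13
  have hmeas : Tendsto (fun k => μ (U k)) atTop (𝓝 0) := by
    have hanti : Antitone U := fun a b hab y hy =>
      le_trans (b := 13 * (s⁻¹) ^ cutTime b) hy
        (mul_le_mul_of_nonneg_left (H.inv_pow_le (cutTime_strictMono.monotone hab)) (by norm_num))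
    have := tendsto_measure_iInter_atTop (μ := μ) (fun k => (hUm k).nullMeasurableSet) hanti
      ⟨0, measure_ne_top _ _⟩
    have hI : ⋂ k, U k = {origin} := by
      ext y
      rw [mem_iInter, mem_singleton_iff]
      constructor
      · intro hy
        have h1 : |(y : ℝ)| ≤ 0 := ge_of_tendsto' hlim hy
        exact Subtype.ext (abs_nonpos_iff.1 h1)
      · rintro rfl k
        have : 0 < (s⁻¹) ^ cutTime k := pow_pos (inv_pos.2 hs.1) _
        change |(0 : ℝ)| ≤ _
        rw [abs_zero]; positivity
    rwa [hI, H.measure_origin hμ] at this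
  have h0 : Tendsto (fun k => ∫⁻ y in U k, F y ∂(μ.restrict {y : Seg | |(y : ℝ)| < δ})) atTop
      (𝓝 0) := by
    refine tendsto_setLIntegral_zero hfin ?_
    refine tendsto_of_tendsto_of_tendsto_of_le_of_le tendsto_const_nhds hmeas
      (fun _ => zero_le) fun k => Measure.restrict_apply_le _ _
  -- Lower bound for the integrals over the sets `U k`.
  set q : ℝ := Real.log s / 8
  have hq : 0 < q := by positivity
  have hct : Tendsto (fun k => (cutTime k : ℝ)) atTop atTop :=
    tendsto_natCast_atTop_atTop.comp cutTime_strictMono.tendsto_atTop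
  have hlow : ∀ᶠ k in atTop, ENNReal.ofReal q ≤
      ∫⁻ y in U k, F y ∂(μ.restrict {y : Seg | |(y : ℝ)| < δ}) := by
    filter_upwards [hlim.eventually (gt_mem_nhds hδ),
      hct.eventually_ge_atTop (2 * Real.log 13 / Real.log s)] with k hk1 hk2
    have hsub : U k ⊆ {y : Seg | |(y : ℝ)| < δ} := fun y hy => lt_of_le_of_lt hy hk1
    rw [Measure.restrict_restrict (hUm k), inter_eq_left.2 hsub]
    rw [div_le_iff₀ hls] at hk2
    have hae : ∀ᵐ y ∂(μ.restrict (U k)), ENNReal.ofReal ((cutTime (k + 2) + 1 : ℕ) * q) ≤ F y := by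
      have hne : ∀ᵐ y ∂(μ.restrict (U k)), y ≠ origin :=
        ae_restrict_of_ae (compl_mem_ae_iff.2 (H.measure_origin hμ))
      filter_upwards [hne, ae_restrict_mem (hUm k)] with y hy0 hyU
      refine ENNReal.ofReal_le_ofReal ?_
      have hy0' : (y : ℝ) ≠ 0 := fun h => hy0 (Subtype.ext h)
      have h1 := Real.log_le_log (abs_pos.2 hy0') hyU
      rw [log_mul_inv_pow (by norm_num) hs.1] at h1
      have h2 : cutTime (k + 2) + 1 ≤ 4 * cutTime k := by
        have a1 := cutTime_succ_le k
        have a2 := cutTime_add_two k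
        have a3 := cutTime_pos k
        omega
      have h3 : ((cutTime (k + 2) + 1 : ℕ) : ℝ) ≤ 4 * cutTime k := by exact_mod_cast h2
      have h4 : ((cutTime (k + 2) + 1 : ℕ) : ℝ) * q ≤ 4 * cutTime k * q :=
        mul_le_mul_of_nonneg_right h3 hq.le
      have h5 : 4 * (cutTime k : ℝ) * q = cutTime k * Real.log s / 2 := by
        simp only [q]; ring
      linarith
    calc ENNReal.ofReal q = ENNReal.ofReal q * 1 := (mul_one _).symm
      _ ≤ ENNReal.ofReal q * ((cutTime (k + 2) + 1 : ℕ) * μ (U k)) :=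
        mul_le_mul_right (H.one_le_mul_measure hμ hsupp k) _
      _ = ENNReal.ofReal ((cutTime (k + 2) + 1 : ℕ) * q) * μ (U k) := by
        rw [ENNReal.ofReal_mul (Nat.cast_nonneg _), ENNReal.ofReal_natCast]; ring
      _ = ∫⁻ y in U k, ENNReal.ofReal ((cutTime (k + 2) + 1 : ℕ) * q) ∂μ := by
        rw [setLIntegral_const]
      _ ≤ _ := lintegral_mono_ae hae
  have := ge_of_tendsto h0 hlow
  exact absurd this (not_le.2 (ENNReal.ofReal_pos.2 hq))

end Measure

end IsFibTent

end Tent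

/-! ### Calculus for self-maps of `[-1,1]` -/

theorem toReal_coe (g : Seg → Seg) (x : Seg) : toReal g x = g x := IccExtend_val _ _ _

theorem toReal_comp (g f : Seg → Seg) : toReal (g ∘ f) = toReal g ∘ toReal f := by
  funext t
  exact (toReal_coe g _).symm

theorem mapsTo_toReal (g : Seg → Seg) : MapsTo (toReal g) (Icc (-1) 1) (Icc (-1) 1) :=
  fun _ _ => (g _).2

theorem uniqueDiff (x : Seg) : UniqueDiffWithinAt ℝ (Icc (-1 : ℝ) 1) x :=
  uniqueDiffOn_Icc (by norm_num) x x.2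

theorem eventually_coe {P : ℝ → Prop} {x : Seg} :
    (∀ᶠ z in 𝓝[Icc (-1) 1] (x : ℝ), P z) ↔ ∀ᶠ z : Seg in 𝓝 x, P z := by
  rw [nhdsWithin_eq_map_subtype_coe x.2, eventually_map]

theorem toReal_eventuallyEq {g : Seg → Seg} {φ : ℝ → ℝ} {x : Seg}
    (h : ∀ᶠ z : Seg in 𝓝 x, (g z : ℝ) = φ z) : toReal g =ᶠ[𝓝[Icc (-1) 1] (x : ℝ)] φ :=
  eventually_coe.2 (h.mono fun z hz => (toReal_coe g z).trans hz)

theorem hasDerivWithinAt_comp {g f : Seg → Seg} {a b : ℝ} {x : Seg}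
    (hg : HasDerivWithinAt (toReal g) a (Icc (-1) 1) (f x))
    (hf : HasDerivWithinAt (toReal f) b (Icc (-1) 1) x) :
    HasDerivWithinAt (toReal (g ∘ f)) (a * b) (Icc (-1) 1) x := by
  rw [toReal_comp]
  rw [← toReal_coe] at hg
  exact hg.comp (x : ℝ) hf (mapsTo_toReal f)

theorem AnalyticPt.comp {g f : Seg → Seg} {x : Seg} (hg : AnalyticPt g (f x))
    (hf : AnalyticPt f x) : AnalyticPt (g ∘ f) x := by
  unfold AnalyticPt at *
  rw [toReal_comp]
  rw [← toReal_coe] at hg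
  exact hg.comp hf (mapsTo_toReal f)

theorem der_eq {g : Seg → Seg} {a : ℝ} {x : Seg}
    (h : HasDerivWithinAt (toReal g) a (Icc (-1) 1) x) : der g x = a :=
  h.derivWithin (uniqueDiff x)

theorem hasDerivWithinAt_der {g : Seg → Seg} {x : Seg} (h : DiffAt g x) :
    HasDerivWithinAt (toReal g) (der g x) (Icc (-1) 1) x := h.hasDerivWithinAt

theorem AnalyticPt.diffAt {g : Seg → Seg} {x : Seg} (h : AnalyticPt g x) : DiffAt g x := by
  have := AnalyticWithinAt.differentiableWithinAt h
  rwa [insert_eq_of_mem x.2] at this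

/-- At an endpoint too, an analytic map extends to a function that is analytic at the point; near
the point, the derivatives agree. -/
theorem AnalyticPt.exists_analyticAt {g : Seg → Seg} {x : Seg} (h : AnalyticPt g x) :
    ∃ G : ℝ → ℝ, AnalyticAt ℝ G x ∧ ∀ᶠ z : Seg in 𝓝 x, (g z : ℝ) = G z ∧ der g z = deriv G z := by
  obtain ⟨G, hG, hGa⟩ := analyticWithinAt_iff_exists_analyticAt.1 h
  rw [insert_eq_of_mem x.2] at hG
  refine ⟨G, hGa, ?_⟩
  have h1 : ∀ᶠ z : Seg in 𝓝 x, AnalyticAt ℝ G z :=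
    continuous_subtype_val.continuousAt.eventually hGa.eventually_analyticAt
  have h2 : ∀ᶠ z : Seg in 𝓝 x, (g z : ℝ) = G z :=
    (eventually_coe.1 hG).mono fun z hz => (toReal_coe g z).symm.trans hz
  filter_upwards [h1, h2.eventually_nhds] with z hz1 hz2
  refine ⟨hz2.self_of_nhds, ?_⟩
  refine der_eq (hz1.differentiableAt.hasDerivAt.hasDerivWithinAt.congr_of_eventuallyEq
    (toReal_eventuallyEq hz2) ?_)
  rw [toReal_coe]
  exact hz2.self_of_nhds

theorem AnalyticPt.continuousAt_der {g : Seg → Seg} {x : Seg} (h : AnalyticPt g x) :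
    ContinuousAt (der g) x := by
  obtain ⟨G, hG, hev⟩ := h.exists_analyticAt
  have h1 : ContinuousAt (fun z : Seg => deriv G z) x :=
    hG.deriv.continuousAt.comp (f := fun z : Seg => (z : ℝ)) continuous_subtype_val.continuousAt
  exact h1.congr (hev.mono fun z hz => hz.2.symm)

/-- The inverse of an analytic homeomorphism is analytic at the image of a noncritical point. -/
theorem AnalyticPt.symm {h : Seg ≃ₜ Seg} {y : Seg} (ha : AnalyticPt h y) (hd : der h y ≠ 0) :
    AnalyticPt h.symm (h y) := by
  obtain ⟨G, hG, hev⟩ := ha.exists_analyticAt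
  have hGd : deriv G y ≠ 0 := by rwa [← hev.self_of_nhds.2]
  have hGy : G y = h y := hev.self_of_nhds.1.symm
  have hinv := hG.analyticAt_localInverse hGd
  have hleft := hG.hasStrictDerivAt.eventually_left_inverse hGd
  set R := hG.hasStrictDerivAt.localInverse _ _ _ hGd
  rw [hGy] at hinv
  have hev2 : ∀ᶠ z : Seg in 𝓝 y, R (h z) = z := by
    filter_upwards [hev, continuous_subtype_val.continuousAt.eventually hleft] with z h1 h2
    rw [h1.1]
    exact h2
  have hev3 : ∀ᶠ w : Seg in 𝓝 (h y), (h.symm w : ℝ) = R w := by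
    have hc : Tendsto h.symm (𝓝 (h y)) (𝓝 y) := by
      have := h.symm.continuous.tendsto (h y)
      rwa [h.symm_apply_apply] at this
    filter_upwards [hc.eventually hev2] with w hw
    rw [h.apply_symm_apply] at hw
    exact hw.symm
  refine (hinv.analyticWithinAt (s := Icc (-1) 1)).congr_of_eventuallyEq
    (toReal_eventuallyEq hev3) ?_
  rw [toReal_coe]
  exact hev3.self_of_nhds

theorem hasDerivWithinAt_symm {h : Seg ≃ₜ Seg} {y : Seg} (ha : AnalyticPt h y)
    (hd : der h y ≠ 0) :
    HasDerivWithinAt (toReal h.symm) (der h y)⁻¹ (Icc (-1) 1) (h y) := by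
  have h1 := hasDerivWithinAt_der (ha.symm hd).diffAt
  have h2 := hasDerivWithinAt_comp h1 (hasDerivWithinAt_der ha.diffAt)
  have h3 : HasDerivWithinAt (toReal (h.symm ∘ h)) 1 (Icc (-1) 1) y :=
    (hasDerivWithinAt_id (y : ℝ) _).congr_of_eventuallyEq
      (toReal_eventuallyEq (Eventually.of_forall fun z => by simp)) (by rw [toReal_coe]; simp)
  have h4 : der h.symm (h y) * der h y = 1 := (uniqueDiff y).eq_deriv _ h2 h3
  rwa [eq_inv_of_mul_eq_one_left h4] at h1

/-! ### Iterates of the tent map -/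

section Tent

variable {s : ℝ} {hs : s ∈ Ioc (0 : ℝ) 2}

theorem eventually_tent_eq {y : Seg} (hy : y ≠ origin) :
    ∃ a : ℝ, |a| = s ∧ ∀ᶠ z : Seg in 𝓝 y, (tent s hs z : ℝ) = tent s hs y + a * ((z : ℝ) - y) := by
  have hy0 : (y : ℝ) ≠ 0 := fun h => hy (Subtype.ext h)
  rcases lt_or_gt_of_ne hy0 with h | h
  · refine ⟨s, abs_of_pos hs.1, ?_⟩
    filter_upwards [continuous_subtype_val.continuousAt.eventually (gt_mem_nhds h)] with z hz
    rw [tent_val, tent_val, abs_of_neg hz, abs_of_neg h]; ring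
  · refine ⟨-s, by rw [abs_neg, abs_of_pos hs.1], ?_⟩
    filter_upwards [continuous_subtype_val.continuousAt.eventually (lt_mem_nhds h)] with z hz
    rw [tent_val, tent_val, abs_of_pos hz, abs_of_pos h]; ring

/-- Until the orbit of `y` meets the turning point, the iterates of the tent map are affine near
`y`. -/
theorem eventually_iterate_tent_eq {y : Seg} {n : ℕ}
    (hy : ∀ i < n, (tent s hs)^[i] y ≠ origin) :
    ∃ a : ℝ, |a| = s ^ n ∧ ∀ᶠ z : Seg in 𝓝 y,
      ((tent s hs)^[n] z : ℝ) = (tent s hs)^[n] y + a * ((z : ℝ) - y) := by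
  induction n with
  | zero => exact ⟨1, by simp, by simp⟩
  | succ n ih =>
    obtain ⟨a, ha, h1⟩ := ih fun i hi => hy i (by omega)
    obtain ⟨b, hb, h2⟩ := eventually_tent_eq (hs := hs) (hy n (by omega))
    refine ⟨b * a, by rw [abs_mul, ha, hb, pow_succ'], ?_⟩
    filter_upwards [h1, ((continuous_tent (hs := hs)).iterate n).continuousAt.eventually h2]
      with z h3 h4
    rw [Function.iterate_succ_apply', Function.iterate_succ_apply', h4, h3]
    ring

theorem hasDerivWithinAt_of_affine {g : Seg → Seg} {y : Seg} {a : ℝ}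
    (h : ∀ᶠ z : Seg in 𝓝 y, (g z : ℝ) = g y + a * ((z : ℝ) - y)) :
    HasDerivWithinAt (toReal g) a (Icc (-1) 1) y := by
  have h1 : HasDerivAt (fun t : ℝ => (g y : ℝ) + a * (t - y)) a y := by
    simpa using (((hasDerivAt_id (y : ℝ)).sub_const (y : ℝ)).const_mul a).const_add (g y : ℝ)
  exact h1.hasDerivWithinAt.congr_of_eventuallyEq
    (toReal_eventuallyEq (φ := fun t : ℝ => (g y : ℝ) + a * (t - y)) h) (by rw [toReal_coe]; ring)

theorem analyticPt_tent {y : Seg} (hy : y ≠ origin) : AnalyticPt (tent s hs) y := by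
  obtain ⟨a, -, h⟩ := eventually_tent_eq (hs := hs) hy
  have h1 : AnalyticAt ℝ (fun t : ℝ => (tent s hs y : ℝ) + a * (t - y)) y := by fun_prop
  exact h1.analyticWithinAt.congr_of_eventuallyEq
    (toReal_eventuallyEq (φ := fun t : ℝ => (tent s hs y : ℝ) + a * (t - y)) h)
    (by rw [toReal_coe]; ring)

theorem abs_iterate_tent_eq_one (n : ℕ) (y : Seg) (hy : |(y : ℝ)| = 1) :
    |((tent s hs)^[n] y : ℝ)| = 1 := by
  induction n with
  | zero => exact hy
  | succ n ih =>
    rw [Function.iterate_succ_apply', tent_val, ih]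
    norm_num

theorem iterate_ne_origin_of_hit (H : IsFibTent s hs) {y : Seg} {m n : ℕ} (hmn : m < n)
    (hm : (tent s hs)^[m] y = origin) : (tent s hs)^[n] y ≠ origin := by
  intro h
  obtain ⟨j, rfl⟩ : ∃ j, n = j + m := ⟨n - m, by omega⟩
  rw [Function.iterate_add_apply, hm] at h
  exact H.ne_zero j (by omega) (by rw [crit, h]; rfl)

/-- Once the orbit of `y` has met the turning point, `T ^ n` has a corner at `y`. -/
theorem not_diffAt_iterate_tent (H : IsFibTent s hs) {y : Seg} {m n : ℕ} (hmn : m < n)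
    (hm : (tent s hs)^[m] y = origin) : ¬ DiffAt (tent s hs)^[n] y := by
  have hno : ∀ i < m, (tent s hs)^[i] y ≠ origin := fun i hi h =>
    iterate_ne_origin_of_hit H hi h hm
  obtain ⟨a, ha, h1⟩ := eventually_iterate_tent_eq hno
  obtain ⟨j, rfl⟩ : ∃ j, n = j + (m + 1) := ⟨n - (m + 1), by omega⟩
  have hno2 : ∀ i < j, (tent s hs)^[i] ((tent s hs)^[m + 1] y) ≠ origin := fun i _ => by
    rw [← Function.iterate_add_apply]
    exact iterate_ne_origin_of_hit H (by omega) hm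
  obtain ⟨b, hb, h2⟩ := eventually_iterate_tent_eq hno2
  have h0 : ((origin : Seg) : ℝ) = 0 := rfl
  have hev : ∀ᶠ z : Seg in 𝓝 y, ((tent s hs)^[j + (m + 1)] z : ℝ) =
      (tent s hs)^[j + (m + 1)] y - (b * s ^ (m + 1)) * |(z : ℝ) - y| := by
    filter_upwards [h1, ((continuous_tent (hs := hs)).iterate (m + 1)).continuousAt.eventually h2]
      with z h3 h4
    rw [Function.iterate_add_apply, Function.iterate_add_apply (m := j), h4,
      Function.iterate_succ_apply' (tent s hs) m, Function.iterate_succ_apply' (tent s hs) m,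
      hm, tent_val, tent_val, h3, hm, h0, zero_add, abs_mul, ha, abs_zero]
    ring
  have hb0 : b * s ^ (m + 1) ≠ 0 := by
    refine mul_ne_zero ?_ (pow_pos hs.1 _).ne'
    intro hb0
    rw [hb0, abs_zero] at hb
    exact (pow_pos hs.1 j).ne hb
  have hint : Icc (-1 : ℝ) 1 ∈ 𝓝 (y : ℝ) := by
    have hy1 : |(y : ℝ)| ≠ 1 := fun h => by
      have := abs_iterate_tent_eq_one (s := s) (hs := hs) m y h
      rw [hm, h0, abs_zero] at this
      exact zero_ne_one this
    have hy2 : |(y : ℝ)| < 1 := lt_of_le_of_ne (abs_le.2 y.2) hy1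
    exact Icc_mem_nhds (abs_lt.1 hy2).1 (abs_lt.1 hy2).2
  intro hd
  have hd1 : DifferentiableAt ℝ (fun t : ℝ => ((tent s hs)^[j + (m + 1)] y : ℝ) -
      (b * s ^ (m + 1)) * |t - y|) y :=
    (DifferentiableWithinAt.congr_of_eventuallyEq hd
      (toReal_eventuallyEq (φ := fun t : ℝ => ((tent s hs)^[j + (m + 1)] y : ℝ) -
        (b * s ^ (m + 1)) * |t - y|) hev).symm (by rw [toReal_coe]; simp)).differentiableAt hint
  have hd2 : DifferentiableAt ℝ (fun t : ℝ => |t|) 0 := by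
    have h5 : DifferentiableAt ℝ (fun t : ℝ => (((tent s hs)^[j + (m + 1)] y : ℝ) -
        (((tent s hs)^[j + (m + 1)] y : ℝ) - (b * s ^ (m + 1)) * |t + y - y|)) /
          (b * s ^ (m + 1))) 0 := by
      refine ((differentiableAt_const _).sub ?_).div_const _
      refine DifferentiableAt.comp (g := fun t : ℝ => ((tent s hs)^[j + (m + 1)] y : ℝ) -
        (b * s ^ (m + 1)) * |t - y|) (f := fun t : ℝ => t + y) 0 ?_ (by fun_prop)
      simpa using hd1
    refine h5.congr_of_eventuallyEq (Eventually.of_forall fun t => ?_)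
    beta_reduce
    rw [sub_sub_cancel, add_sub_cancel_right, mul_div_cancel_left₀ _ hb0]
  exact not_differentiableAt_abs_zero hd2

end Tent

/-! ### The conjugacy near its critical point -/

/-- A homeomorphism of `[-1,1]` that is analytic off `0` and has `0` as its unique critical point,
which is non-flat. -/
structure IsCriticalConjugacy (h : Seg ≃ₜ Seg) : Prop where
  analytic : ∀ x : Seg, x ≠ origin → AnalyticPt h x
  crit_eq : Crit h = {origin}
  nonflat : IsNonflatCritical h origin

/-- Two-sided power bounds for `φ'` on `(0, y)` give such bounds for the increment of `φ`, by
Cauchy's mean value theorem for `φ` and `t ^ (r + 1)`. -/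
theorem abs_sub_bounds {φ φ' : ℝ → ℝ} {y r A B : ℝ} (hy : 0 < y) (hr : 0 < r)
    (hc : ContinuousOn φ (Icc 0 y)) (hd : ∀ t ∈ Ioo 0 y, HasDerivAt φ (φ' t) t)
    (hb : ∀ t ∈ Ioo 0 y, A * t ^ r ≤ |φ' t| ∧ |φ' t| ≤ B * t ^ r) :
    A / (r + 1) * y ^ (r + 1) ≤ |φ y - φ 0| ∧ |φ y - φ 0| ≤ B / (r + 1) * y ^ (r + 1) := by
  have hr1 : 0 < r + 1 := by linarith
  obtain ⟨t, ht, heq⟩ := exists_ratio_hasDerivAt_eq_ratio_slope φ φ' hy hc hd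
    (fun t => t ^ (r + 1)) (fun t => (r + 1) * t ^ r)
    (Real.continuous_rpow_const hr1.le).continuousOn
    (fun t ht => by
      have := Real.hasDerivAt_rpow_const (x := t) (p := r + 1) (Or.inl ht.1.ne')
      simpa using this)
  simp only [Real.zero_rpow hr1.ne', sub_zero] at heq
  have htr : 0 < t ^ r := Real.rpow_pos_of_pos ht.1 r
  have hyr : 0 < y ^ (r + 1) := Real.rpow_pos_of_pos hy _
  have h1 : y ^ (r + 1) * |φ' t| = |φ y - φ 0| * ((r + 1) * t ^ r) := by
    rw [← abs_of_pos hyr, ← abs_mul, heq, abs_mul, abs_of_pos (mul_pos hr1 htr)]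
  obtain ⟨h2, h3⟩ := hb t ht
  have hpos := mul_pos hr1 htr
  constructor
  · refine le_of_mul_le_mul_right ?_ hpos
    rw [← h1]
    calc A / (r + 1) * y ^ (r + 1) * ((r + 1) * t ^ r) = y ^ (r + 1) * (A * t ^ r) := by
          field_simp
      _ ≤ _ := mul_le_mul_of_nonneg_left h2 hyr.le
  · refine le_of_mul_le_mul_right ?_ hpos
    rw [← h1]
    calc y ^ (r + 1) * |φ' t| ≤ y ^ (r + 1) * (B * t ^ r) := mul_le_mul_of_nonneg_left h3 hyr.le
      _ = _ := by field_simp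

/-- On the side of the critical point where `σ * y > 0`, the derivative of `h` is comparable to
`|y| ^ r`, and `|h y - h 0|` to `|y| ^ (r + 1)`. -/
def HasPowerBounds (h : Seg → Seg) (σ r : ℝ) : Prop :=
  ∃ A > 0, ∃ B > 0, ∃ δ > 0, ∀ y : Seg, 0 < σ * y → σ * y < δ →
    (A * |(y : ℝ)| ^ r ≤ |der h y| ∧ |der h y| ≤ B * |(y : ℝ)| ^ r) ∧
    (A * |(y : ℝ)| ^ (r + 1) ≤ |(h y : ℝ) - h origin| ∧
      |(h y : ℝ) - h origin| ≤ B * |(y : ℝ)| ^ (r + 1))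

theorem bounds_of_abs_log_div_le {d p M : ℝ} (hd : d ≠ 0) (hp : 0 < p)
    (h : |Real.log (|d| / p)| ≤ M) : Real.exp (-M) * p ≤ |d| ∧ |d| ≤ Real.exp M * p := by
  have hq : 0 < |d| / p := div_pos (abs_pos.2 hd) hp
  obtain ⟨h1, h2⟩ := abs_le.1 h
  constructor
  · rw [← le_div_iff₀ hp]
    exact (Real.le_log_iff_exp_le hq).1 h1
  · rw [← div_le_iff₀ hp]
    exact (Real.log_le_iff_le_exp hq).1 h2

namespace IsCriticalConjugacy

variable {h : Seg ≃ₜ Seg} (K : IsCriticalConjugacy h)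
include K

theorem hasDerivWithinAt_origin : HasDerivWithinAt (toReal h) 0 (Icc (-1) 1) (origin : Seg) := by
  have : origin ∈ Crit h := by rw [K.crit_eq]; rfl
  exact this

theorem hasDerivWithinAt (y : Seg) : HasDerivWithinAt (toReal h) (der h y) (Icc (-1) 1) y := by
  by_cases hy : y = origin
  · rw [hy, der_eq K.hasDerivWithinAt_origin]; exact K.hasDerivWithinAt_origin
  · exact hasDerivWithinAt_der (K.analytic y hy).diffAt

theorem der_ne_zero {y : Seg} (hy : y ≠ origin) : der h y ≠ 0 := by
  intro h0
  have h1 := K.hasDerivWithinAt y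
  rw [h0] at h1
  have : y ∈ Crit h := h1
  rw [K.crit_eq] at this
  exact hy this

theorem hasPowerBounds_of_side {σ r M δ : ℝ} (hσ : σ = 1 ∨ σ = -1) (hr : 0 < r) (hδ : 0 < δ)
    (hb : ∀ y : Seg, 0 < σ * y → σ * y < δ →
      der h y ≠ 0 ∧ |Real.log (|der h y| / |(y : ℝ)| ^ r)| ≤ M) :
    HasPowerBounds h σ r := by
  have hr1 : 0 < r + 1 := by linarith
  have hσσ : σ * σ = 1 := by rcases hσ with rfl | rfl <;> norm_num
  have habs : |σ| = 1 := by rcases hσ with rfl | rfl <;> norm_num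
  have hmem : ∀ t ∈ Icc (0 : ℝ) 1, σ * t ∈ Icc (-1 : ℝ) 1 := fun t ht => by
    rw [mem_Icc, ← abs_le, abs_mul, habs, one_mul, abs_of_nonneg ht.1]; exact ht.2
  have habs' : ∀ y : Seg, 0 < σ * y → |(y : ℝ)| = σ * y := fun y hy => by
    rw [← abs_of_pos hy, abs_mul, habs, one_mul]
  have hder : ∀ y : Seg, 0 < σ * y → σ * y < δ →
      Real.exp (-M) * |(y : ℝ)| ^ r ≤ |der h y| ∧ |der h y| ≤ Real.exp M * |(y : ℝ)| ^ r :=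
    fun y h1 h2 => by
      obtain ⟨h3, h4⟩ := hb y h1 h2
      refine bounds_of_abs_log_div_le h3 (Real.rpow_pos_of_pos ?_ _) h4
      rw [habs' y h1]; exact h1
  have hinc : ∀ y : Seg, 0 < σ * y → σ * y < δ →
      Real.exp (-M) / (r + 1) * |(y : ℝ)| ^ (r + 1) ≤ |(h y : ℝ) - h origin| ∧
      |(h y : ℝ) - h origin| ≤ Real.exp M / (r + 1) * |(y : ℝ)| ^ (r + 1) := by
    intro y h1 h2
    have hy1 : σ * y ≤ 1 := by rw [← habs' y h1]; exact abs_le.2 y.2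
    have hcont : Continuous (toReal h) :=
      (continuous_subtype_val.comp h.continuous).Icc_extend'
    have := abs_sub_bounds (φ := fun t => toReal h (σ * t))
      (φ' := fun t => derivWithin (toReal h) (Icc (-1) 1) (σ * t) * σ) (y := σ * y)
      (A := Real.exp (-M)) (B := Real.exp M) h1 hr
      (hcont.comp (continuous_const.mul continuous_id)).continuousOn (fun t ht => ?_)
      (fun t ht => ?_)
    · have e : σ * (σ * (y : ℝ)) = y := by rw [← mul_assoc, hσσ, one_mul]
      have e0 : toReal h (σ * 0) = h origin := by
        rw [mul_zero]; exact toReal_coe h origin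
      simp only [e, e0, toReal_coe] at this
      rwa [habs' y h1]
    · have ht1 : t < 1 := lt_of_lt_of_le ht.2 hy1
      have hx := hmem t ⟨ht.1.le, ht1.le⟩
      have hlt : |σ * t| < 1 := by rwa [abs_mul, habs, one_mul, abs_of_pos ht.1]
      have hd := (K.hasDerivWithinAt ⟨σ * t, hx⟩).hasDerivAt
        (Icc_mem_nhds (abs_lt.1 hlt).1 (abs_lt.1 hlt).2)
      have hlin : HasDerivAt (fun t : ℝ => σ * t) σ t := by
        simpa using (hasDerivAt_id t).const_mul σ
      exact hd.comp t hlin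
    · have ht1 : t < 1 := lt_of_lt_of_le ht.2 hy1
      have hx := hmem t ⟨ht.1.le, ht1.le⟩
      have e : σ * (σ * t) = t := by rw [← mul_assoc, hσσ, one_mul]
      have := hder ⟨σ * t, hx⟩ (by simpa only [e] using ht.1)
        (by simpa only [e] using ht.2.trans h2)
      have e2 : |σ * t| = t := by rw [abs_mul, habs, one_mul, abs_of_pos ht.1]
      simp only [e2] at this
      rw [abs_mul, habs, mul_one]
      exact this
  refine ⟨Real.exp (-M) / (r + 1), by positivity, Real.exp M, Real.exp_pos _, δ, hδ,
    fun y h1 h2 => ⟨⟨?_, (hder y h1 h2).2⟩, (hinc y h1 h2).1, ?_⟩⟩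
  · refine le_trans (mul_le_mul_of_nonneg_right ?_ (by positivity)) (hder y h1 h2).1
    exact div_le_self (Real.exp_pos _).le (by linarith)
  · refine (hinc y h1 h2).2.trans (mul_le_mul_of_nonneg_right ?_ (by positivity))
    exact div_le_self (Real.exp_pos _).le (by linarith)

theorem exists_hasPowerBounds : ∃ r > 0, ∃ l > 0, HasPowerBounds h 1 r ∧ HasPowerBounds h (-1) l := by
  obtain ⟨-, r, hr, l, hl, M, hM, δ, hδ, h1, h2⟩ := K.nonflat
  have h0 : ((origin : Seg) : ℝ) = 0 := rfl
  simp only [h0, zero_add, zero_sub, sub_zero] at h1 h2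
  refine ⟨r, hr, l, hl, K.hasPowerBounds_of_side (M := M) (Or.inl rfl) hr hδ fun y hy1 hy2 => ?_,
    K.hasPowerBounds_of_side (M := M) (Or.inr rfl) hl hδ fun y hy1 hy2 => ?_⟩
  · rw [one_mul] at hy1 hy2
    exact h1 y hy1 hy2
  · exact h2 y (by linarith) (by linarith)

/-- Logarithmic form of the power bounds, on both sides of the critical point. -/
theorem exists_log_bounds_near : ∃ a > 0, ∃ b > 0, ∃ C, ∃ δ > 0, ∀ y : Seg, y ≠ origin →
    |(y : ℝ)| < δ → Real.log |der h y| ≤ C + a * Real.log |(y : ℝ)| ∧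
      -Real.log |(h y : ℝ) - h origin| ≤ C - b * Real.log |(y : ℝ)| := by
  obtain ⟨r, hr, l, hl, ⟨A, hA, B, hB, δ, hδ, h1⟩, ⟨A', hA', B', hB', δ', hδ', h2⟩⟩ :=
    K.exists_hasPowerBounds
  have key : ∀ {A B r : ℝ} {y : Seg}, 0 < A → 0 < B → 0 < r → y ≠ origin →
      (A * |(y : ℝ)| ^ r ≤ |der h y| ∧ |der h y| ≤ B * |(y : ℝ)| ^ r) ∧
      (A * |(y : ℝ)| ^ (r + 1) ≤ |(h y : ℝ) - h origin| ∧
        |(h y : ℝ) - h origin| ≤ B * |(y : ℝ)| ^ (r + 1)) →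
      Real.log |der h y| ≤ Real.log B + r * Real.log |(y : ℝ)| ∧
      -Real.log |(h y : ℝ) - h origin| ≤ -Real.log A - (r + 1) * Real.log |(y : ℝ)| := by
    intro A B r y hA hB hr hy hb
    have hy0 : 0 < |(y : ℝ)| := abs_pos.2 fun h => hy (Subtype.ext h)
    constructor
    · rw [← Real.log_rpow hy0, ← Real.log_mul hB.ne' (Real.rpow_pos_of_pos hy0 _).ne']
      exact Real.log_le_log (abs_pos.2 (K.der_ne_zero hy)) hb.1.2
    · have h3 := Real.log_le_log (mul_pos hA (Real.rpow_pos_of_pos hy0 (r + 1))) hb.2.1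
      rw [Real.log_mul hA.ne' (Real.rpow_pos_of_pos hy0 _).ne', Real.log_rpow hy0] at h3
      linarith
  refine ⟨min r l, lt_min hr hl, max r l + 1, by positivity,
    max (max (Real.log B) (Real.log B')) (max (-Real.log A) (-Real.log A')), min δ δ',
    lt_min hδ hδ', fun y hy hyδ => ?_⟩
  have hy0 : (y : ℝ) ≠ 0 := fun h => hy (Subtype.ext h)
  have hlog : Real.log |(y : ℝ)| ≤ 0 := Real.log_nonpos (abs_nonneg _) (abs_le.2 y.2)
  have m1 : Real.log B ≤ max (max (Real.log B) (Real.log B')) (max (-Real.log A) (-Real.log A')) :=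
    (le_max_left _ _).trans (le_max_left _ _)
  have m2 : Real.log B' ≤ max (max (Real.log B) (Real.log B')) (max (-Real.log A) (-Real.log A')) :=
    (le_max_right _ _).trans (le_max_left _ _)
  have m3 : -Real.log A ≤ max (max (Real.log B) (Real.log B')) (max (-Real.log A) (-Real.log A')) :=
    (le_max_left _ _).trans (le_max_right _ _)
  have m4 : -Real.log A' ≤ max (max (Real.log B) (Real.log B')) (max (-Real.log A) (-Real.log A')) :=
    (le_max_right _ _).trans (le_max_right _ _)
  rcases lt_or_gt_of_ne hy0 with hn | hp
  · rw [abs_of_neg hn] at hyδ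
    obtain ⟨k1, k2⟩ := key hA' hB' hl hy (h2 y (by linarith)
      (by linarith [min_le_right δ δ']))
    have := mul_le_mul_of_nonpos_right (min_le_right r l) hlog
    have := mul_le_mul_of_nonpos_right (add_le_add_left (le_max_right r l) 1) hlog
    constructor <;> linarith
  · rw [abs_of_pos hp] at hyδ
    obtain ⟨k1, k2⟩ := key hA hB hr hy (h1 y (by linarith)
      (by linarith [min_le_left δ δ']))
    have := mul_le_mul_of_nonpos_right (min_le_left r l) hlog
    have := mul_le_mul_of_nonpos_right (add_le_add_left (le_max_left r l) 1) hlog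
    constructor <;> linarith

/-- Away from the critical point, all logarithms are bounded. -/
theorem exists_abs_log_le {δ : ℝ} (hδ : 0 < δ) : ∃ C, ∀ y : Seg, δ ≤ |(y : ℝ)| →
    |Real.log (|der h y|)| ≤ C ∧ |Real.log (|(h y : ℝ) - h origin|)| ≤ C := by
  have hcl : IsCompact {y : Seg | δ ≤ |(y : ℝ)|} :=
    (isClosed_le continuous_const continuous_subtype_val.abs).isCompact
  have hne : ∀ y : Seg, δ ≤ |(y : ℝ)| → y ≠ origin := by
    rintro y hy rfl
    have h0 : ((origin : Seg) : ℝ) = 0 := rfl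
    rw [h0, abs_zero] at hy
    linarith
  obtain ⟨C1, h1⟩ := hcl.exists_bound_of_continuousOn (f := fun y => Real.log (|der h y|))
    fun y hy => (((K.analytic y (hne y hy)).continuousAt_der.abs).log
      (abs_pos.2 (K.der_ne_zero (hne y hy))).ne').continuousWithinAt
  obtain ⟨C2, h2⟩ := hcl.exists_bound_of_continuousOn
    (f := fun y => Real.log (|(h y : ℝ) - h origin|)) fun y hy => by
      refine ContinuousAt.continuousWithinAt (ContinuousAt.log ?_ ?_)
      · exact (((continuous_subtype_val.comp h.continuous).sub continuous_const).abs).continuousAt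
      · refine (abs_pos.2 (sub_ne_zero.2 fun he => hne y hy ?_)).ne'
        exact h.injective (Subtype.ext he)
  refine ⟨max C1 C2, fun y hy => ⟨?_, ?_⟩⟩
  · exact (h1 y hy).trans (le_max_left _ _)
  · exact (h2 y hy).trans (le_max_right _ _)

theorem exists_log_bounds : ∃ a > 0, ∃ b > 0, ∃ C, ∀ y : Seg, y ≠ origin →
    Real.log |der h y| ≤ C + a * Real.log |(y : ℝ)| ∧
      -Real.log |(h y : ℝ) - h origin| ≤ C - b * Real.log |(y : ℝ)| := by
  obtain ⟨a, ha, b, hb, C, δ, hδ, h1⟩ := K.exists_log_bounds_near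
  obtain ⟨C', h2⟩ := K.exists_abs_log_le hδ
  refine ⟨a, ha, b, hb, max C (C' + |a * Real.log δ|), fun y hy => ?_⟩
  have hlog : Real.log |(y : ℝ)| ≤ 0 := Real.log_nonpos (abs_nonneg _) (abs_le.2 y.2)
  have m1 := le_max_left C (C' + |a * Real.log δ|)
  have m2 := le_max_right C (C' + |a * Real.log δ|)
  rcases lt_or_ge (|(y : ℝ)|) δ with hlt | hge
  · obtain ⟨k1, k2⟩ := h1 y hy hlt
    constructor <;> linarith
  · obtain ⟨k1, k2⟩ := h2 y hge
    have k3 := mul_le_mul_of_nonneg_left (Real.log_le_log hδ hge) ha.le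
    have k4 := neg_abs_le (a * Real.log δ)
    have k5 := mul_nonpos_of_nonneg_of_nonpos hb.le hlog
    have k6 := abs_nonneg (a * Real.log δ)
    constructor
    · linarith [(abs_le.1 k1).2]
    · linarith [(abs_le.1 k2).1]

/-- `h` is Lipschitz at the critical point, since its derivative there is `0`. -/
theorem exists_log_sub_le : ∃ C, ∀ y : Seg, y ≠ origin →
    Real.log |(h y : ℝ) - h origin| ≤ C + Real.log |(y : ℝ)| := by
  have hev : ∀ᶠ z : Seg in 𝓝 origin, |(h z : ℝ) - h origin| ≤ |(z : ℝ)| := by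
    have h1 := (hasDerivWithinAt_iff_isLittleO.1 K.hasDerivWithinAt_origin).def one_pos
    have h2 := eventually_coe.1 h1
    filter_upwards [h2] with z hz
    have h0 : (z : ℝ) - (origin : Seg) = z := sub_zero _
    rw [toReal_coe, toReal_coe, h0] at hz
    simpa using hz
  obtain ⟨δ, hδ, h1⟩ := Metric.eventually_nhds_iff.1 hev
  obtain ⟨C, h2⟩ := K.exists_abs_log_le hδ
  refine ⟨max 0 (C - Real.log δ), fun y hy => ?_⟩
  have m1 := le_max_left 0 (C - Real.log δ)
  have m2 := le_max_right 0 (C - Real.log δ)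
  rcases lt_or_ge (|(y : ℝ)|) δ with hlt | hge
  · have h3 : |(h y : ℝ) - h origin| ≤ |(y : ℝ)| := by
      refine h1 ?_
      change |(y : ℝ) - 0| < δ
      rwa [sub_zero]
    have h4 : 0 < |(h y : ℝ) - h origin| :=
      abs_pos.2 (sub_ne_zero.2 fun he => hy (h.injective (Subtype.ext he)))
    linarith [Real.log_le_log h4 h3]
  · linarith [(abs_le.1 (h2 y hge).2).2, Real.log_le_log hδ hge]

end IsCriticalConjugacy

/-! ### The conjugate map -/

section Conjugate

variable {s : ℝ} {hs : s ∈ Ioc (0 : ℝ) 2} {h : Seg ≃ₜ Seg} {f : Seg → Seg}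

theorem iterate_conj (hf : f = h ∘ tent s hs ∘ h.symm) (n : ℕ) :
    f^[n] = h ∘ (tent s hs)^[n] ∘ h.symm := by
  induction n with
  | zero => funext x; simp
  | succ n ih =>
    funext x
    rw [Function.iterate_succ_apply', ih, hf]
    simpa using ((Function.Commute.refl (tent s hs)).iterate_right n (h.symm x))

theorem iterate_conj_apply (hf : f = h ∘ tent s hs ∘ h.symm) (n : ℕ) (y : Seg) :
    f^[n] (h y) = h ((tent s hs)^[n] y) := by
  rw [iterate_conj hf]; simp

theorem orbit_conj (hf : f = h ∘ tent s hs ∘ h.symm) (y : Seg) :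
    orbit f (h y) = h '' orbit (tent s hs) y := by
  rw [orbit, orbit, ← range_comp]
  congr 1
  funext n
  exact iterate_conj_apply hf n y

theorem strictMonoOn_tent : StrictMonoOn (tent s hs) (Iio origin) := by
  intro x hx y hy hxy
  have hx' : (x : ℝ) < 0 := hx
  have hy' : (y : ℝ) < 0 := hy
  have hxy' : (x : ℝ) < y := hxy
  change (tent s hs x : ℝ) < tent s hs y
  rw [tent_val, tent_val, abs_of_neg hx', abs_of_neg hy']
  nlinarith [hs.1]

theorem strictAntiOn_tent : StrictAntiOn (tent s hs) (Ioi origin) := by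
  intro x hx y hy hxy
  have hx' : (0 : ℝ) < x := hx
  have hy' : (0 : ℝ) < y := hy
  have hxy' : (x : ℝ) < y := hxy
  change (tent s hs y : ℝ) < tent s hs x
  rw [tent_val, tent_val, abs_of_pos hx', abs_of_pos hy']
  nlinarith [hs.1]

theorem continuous_conj (hf : f = h ∘ tent s hs ∘ h.symm) : Continuous f := by
  rw [hf]
  exact h.continuous.comp (continuous_tent.comp h.symm.continuous)

theorem neg_one_lt_origin : (⟨-1, by norm_num⟩ : Seg) < origin := by
  change (-1 : ℝ) < 0
  norm_num

theorem origin_lt_one : origin < (⟨1, by norm_num⟩ : Seg) := by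
  change (0 : ℝ) < 1
  norm_num

theorem isUnimodal_conj (hf : f = h ∘ tent s hs ∘ h.symm) (hm : StrictMono h) :
    IsUnimodal f (h origin) := by
  have hms : StrictMono h.symm := fun x y hxy => hm.lt_iff_lt.1 (by simpa using hxy)
  refine ⟨continuous_conj hf, ?_, ?_, ?_, ?_⟩
  · exact lt_of_le_of_lt (h _).2.1 (hm neg_one_lt_origin)
  · exact lt_of_lt_of_le (hm origin_lt_one) (h _).2.2
  · intro x hx y hy hxy
    rw [hf]
    exact hm (strictMonoOn_tent (by simpa using hms (mem_Iio.1 hx))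
      (by simpa using hms (mem_Iio.1 hy)) (hms hxy))
  · intro x hx y hy hxy
    rw [hf]
    exact hm (strictAntiOn_tent (by simpa using hms (mem_Ioi.1 hx))
      (by simpa using hms (mem_Ioi.1 hy)) (hms hxy))

theorem isReversedUnimodal_conj (hf : f = h ∘ tent s hs ∘ h.symm) (hm : StrictAnti h) :
    IsReversedUnimodal f (h origin) := by
  have hms : StrictAnti h.symm := fun x y hxy => hm.lt_iff_gt.1 (by simpa using hxy)
  refine ⟨continuous_conj hf, ?_, ?_, ?_, ?_⟩
  · exact lt_of_le_of_lt (h _).2.1 (hm origin_lt_one)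
  · exact lt_of_lt_of_le (hm neg_one_lt_origin) (h _).2.2
  · intro x hx y hy hxy
    rw [hf]
    exact hm (strictAntiOn_tent (by simpa using hms (mem_Iio.1 hy))
      (by simpa using hms (mem_Iio.1 hx)) (hms hxy))
  · intro x hx y hy hxy
    rw [hf]
    exact hm (strictMonoOn_tent (by simpa using hms (mem_Ioi.1 hy))
      (by simpa using hms (mem_Ioi.1 hx)) (hms hxy))

theorem tent_origin_ne (H : IsFibTent s hs) : tent s hs origin ≠ origin := fun h0 =>
  H.ne_zero 1 le_rfl (congrArg Subtype.val h0)

theorem strictMono_or_strictAnti (h : Seg ≃ₜ Seg) : StrictMono h ∨ StrictAnti h := by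
  have : Fact ((-1 : ℝ) ≤ 1) := ⟨by norm_num⟩
  exact h.continuous.strictMono_of_inj_boundedOrder' h.injective

namespace IsCriticalConjugacy

variable (K : IsCriticalConjugacy h)
include K

/-- The chain rule for `f^[n]`: the derivatives of `h` at the intermediate points cancel. -/
theorem hasDerivWithinAt_iterate (hf : f = h ∘ tent s hs ∘ h.symm) {y : Seg} (hy : y ≠ origin)
    {n : ℕ} (hn : ∀ i < n, (tent s hs)^[i] y ≠ origin) :
    ∃ a : ℝ, |a| = s ^ n ∧ HasDerivWithinAt (toReal f^[n])
      (der h ((tent s hs)^[n] y) * (a * (der h y)⁻¹)) (Icc (-1) 1) (h y) := by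
  obtain ⟨a, ha, hev⟩ := eventually_iterate_tent_eq hn
  refine ⟨a, ha, ?_⟩
  rw [iterate_conj hf]
  have h1 : HasDerivWithinAt (toReal ((tent s hs)^[n] ∘ h.symm)) (a * (der h y)⁻¹) (Icc (-1) 1)
      (h y) := by
    refine hasDerivWithinAt_comp ?_ (hasDerivWithinAt_symm (K.analytic y hy) (K.der_ne_zero hy))
    rw [h.symm_apply_apply]
    exact hasDerivWithinAt_of_affine hev
  refine hasDerivWithinAt_comp ?_ h1
  rw [Function.comp_apply, h.symm_apply_apply]
  exact K.hasDerivWithinAt _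

theorem abs_der_iterate (hf : f = h ∘ tent s hs ∘ h.symm) {y : Seg} (hy : y ≠ origin)
    {n : ℕ} (hn : ∀ i < n, (tent s hs)^[i] y ≠ origin) :
    |der f^[n] (h y)| = s ^ n * |der h ((tent s hs)^[n] y)| / |der h y| := by
  obtain ⟨a, ha, hd⟩ := K.hasDerivWithinAt_iterate hf hy hn
  rw [der_eq hd, abs_mul, abs_mul, ha, abs_inv]
  ring

theorem log_abs_der_iterate (hf : f = h ∘ tent s hs ∘ h.symm) {y : Seg} (hy : y ≠ origin)
    {n : ℕ} (hn : ∀ i ≤ n, (tent s hs)^[i] y ≠ origin) :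
    Real.log |der f^[n] (h y)| =
      n * Real.log s + Real.log |der h ((tent s hs)^[n] y)| - Real.log |der h y| := by
  have h1 : |der h ((tent s hs)^[n] y)| ≠ 0 := abs_ne_zero.2 (K.der_ne_zero (hn n le_rfl))
  have h2 : |der h y| ≠ 0 := abs_ne_zero.2 (K.der_ne_zero hy)
  have h3 : s ^ n ≠ 0 := (pow_pos hs.1 n).ne'
  rw [K.abs_der_iterate hf hy fun i hi => hn i hi.le, Real.log_div (mul_ne_zero h3 h1) h2,
    Real.log_mul h3 h1, Real.log_pow]

theorem abs_der_conj (hf : f = h ∘ tent s hs ∘ h.symm) {y : Seg} (hy : y ≠ origin) :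
    |der f (h y)| = s * |der h (tent s hs y)| / |der h y| := by
  have := K.abs_der_iterate hf hy (n := 1) (by simpa using hy)
  simpa using this

theorem log_abs_der_conj (hf : f = h ∘ tent s hs ∘ h.symm) {y : Seg} (hy : y ≠ origin)
    (hty : tent s hs y ≠ origin) :
    Real.log |der f (h y)| =
      Real.log s + Real.log |der h (tent s hs y)| - Real.log |der h y| := by
  have := K.log_abs_der_iterate hf hy (n := 1) fun i hi => by
    interval_cases i
    · exact hy
    · exact hty
  simpa using this

theorem mem_singSet (hf : f = h ∘ tent s hs ∘ h.symm) (y : Seg) :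
    h y ∈ SingSet f (h origin) ↔ y = origin ∨ tent s hs y = origin := by
  constructor
  · rintro (hc | hc)
    · by_contra hne
      push Not at hne
      have h1 : der f (h y) = 0 := der_eq hc
      have h2 := K.abs_der_conj hf hne.1
      rw [h1, abs_zero, eq_comm, div_eq_zero_iff, mul_eq_zero, abs_eq_zero, abs_eq_zero] at h2
      rcases h2 with (h2 | h2) | h2
      · exact hs.1.ne' h2
      · exact K.der_ne_zero hne.2 h2
      · exact K.der_ne_zero hne.1 h2
    · exact Or.inl (h.injective hc)
  · intro hc
    by_cases hy : y = origin
    · exact Or.inr (by rw [hy]; rfl)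
    · have hty := hc.resolve_left hy
      left
      obtain ⟨a, -, hd⟩ := K.hasDerivWithinAt_iterate hf hy (n := 1) (by simpa using hy)
      rw [Function.iterate_one, Function.iterate_one, hty, der_eq K.hasDerivWithinAt_origin,
        zero_mul] at hd
      exact hd

theorem analyticPt_conj (hf : f = h ∘ tent s hs ∘ h.symm) {x : Seg}
    (hx : x ∉ SingSet f (h origin)) : AnalyticPt f x := by
  obtain ⟨y, rfl⟩ := h.surjective x
  rw [K.mem_singSet hf, not_or] at hx
  rw [hf]
  refine AnalyticPt.comp ?_ (AnalyticPt.comp ?_ ((K.analytic y hx.1).symm (K.der_ne_zero hx.1)))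
  · rw [Function.comp_apply, h.symm_apply_apply]
    exact K.analytic _ hx.2
  · rw [h.symm_apply_apply]
    exact analyticPt_tent hx.1

/-- On each side of the critical point, `f'` has a power singularity: with `u = |h y - h 0|`, which is
of order `|y| ^ (r + 1)`, the derivative of `h⁻¹` at `h y` is of order
`|y| ^ (-r) = u ^ (-r / (r + 1))`. -/
theorem eventually_lorenz_side (H : IsFibTent s hs) (hf : f = h ∘ tent s hs ∘ h.symm) {σ r : ℝ}
    (hr : 0 < r) (hb : HasPowerBounds h σ r) :
    ∃ ρ ∈ Ioo (0 : ℝ) 1, ∃ L > (0 : ℝ), ∀ᶠ y : Seg in 𝓝 origin, 0 < σ * y →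
      1 / (L * |(h y : ℝ) - h origin| ^ ρ) ≤ |der f (h y)| ∧
        |der f (h y)| ≤ L / |(h y : ℝ) - h origin| ^ ρ := by
  obtain ⟨A, hA, B, hB, δ, hδ, hb⟩ := hb
  have hr1 : 0 < r + 1 := by linarith
  set ρ := r / (r + 1)
  have hρ : ρ ∈ Ioo (0 : ℝ) 1 := ⟨by positivity, (div_lt_one hr1).2 (by linarith)⟩
  set D := |der h (tent s hs origin)|
  have hD : 0 < D := abs_pos.2 (K.der_ne_zero (tent_origin_ne H))
  have hcont : ContinuousAt (fun y : Seg => |der h (tent s hs y)|) origin :=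
    ((K.analytic _ (tent_origin_ne H)).continuousAt_der.comp (f := tent s hs)
      (continuous_tent.continuousAt)).abs
  have hAρ : 0 < A ^ ρ := Real.rpow_pos_of_pos hA _
  have hBρ : 0 < B ^ ρ := Real.rpow_pos_of_pos hB _
  have hs0 := hs.1
  refine ⟨ρ, hρ, max (2 * s * D * B ^ ρ / A) (2 * B / (s * D * A ^ ρ)), by positivity, ?_⟩
  have hσ : ∀ᶠ y : Seg in 𝓝 origin, σ * y < δ := by
    have hc : ContinuousAt (fun y : Seg => σ * (y : ℝ)) origin :=
      (continuous_const.mul continuous_subtype_val).continuousAt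
    refine hc.eventually (gt_mem_nhds ?_)
    change σ * (0 : ℝ) < δ
    rwa [mul_zero]
  filter_upwards [hσ, hcont.eventually (lt_mem_nhds (by linarith : D / 2 < D)),
    hcont.eventually (gt_mem_nhds (by linarith : D < 2 * D))] with y hyδ hD1 hD2 hy
  obtain ⟨⟨d1, d2⟩, u1, u2⟩ := hb y hy hyδ
  have hy0 : (y : ℝ) ≠ 0 := by
    intro h0
    rw [h0, mul_zero] at hy
    exact lt_irrefl _ hy
  have hyo : y ≠ origin := fun h0 => hy0 (by rw [h0]; rfl)
  have hya : 0 < |(y : ℝ)| := abs_pos.2 hy0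
  rw [K.abs_der_conj hf hyo]
  set d := |der h y|
  have hd : 0 < d := abs_pos.2 (K.der_ne_zero hyo)
  set u := |(h y : ℝ) - h origin|
  set p := |(y : ℝ)| ^ r
  set q := |(y : ℝ)| ^ (r + 1)
  have hp : 0 < p := Real.rpow_pos_of_pos hya _
  have hq : 0 < q := Real.rpow_pos_of_pos hya _
  have hqρ : q ^ ρ = p := by
    rw [← Real.rpow_mul hya.le, mul_div_cancel₀ _ hr1.ne']
  have hu : 0 < u := (mul_pos hA hq).trans_le u1
  have v1 : A ^ ρ * p ≤ u ^ ρ := by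
    rw [← hqρ, ← Real.mul_rpow hA.le hq.le]
    exact Real.rpow_le_rpow (by positivity) u1 hρ.1.le
  have v2 : u ^ ρ ≤ B ^ ρ * p := by
    rw [← hqρ, ← Real.mul_rpow hB.le hq.le]
    exact Real.rpow_le_rpow hu.le u2 hρ.1.le
  have hv : 0 < u ^ ρ := Real.rpow_pos_of_pos hu _
  set v := u ^ ρ
  set E := |der h (tent s hs y)|
  set L := max (2 * s * D * B ^ ρ / A) (2 * B / (s * D * A ^ ρ))
  have hL : 0 < L := lt_of_lt_of_le (by positivity) (le_max_left _ _)
  have L1 : 2 * s * D * B ^ ρ ≤ L * A := (div_le_iff₀ hA).1 (le_max_left _ _)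
  have L2 : 2 * B ≤ L * (s * D * A ^ ρ) := (div_le_iff₀ (by positivity)).1 (le_max_right _ _)
  constructor
  · rw [div_le_div_iff₀ (by positivity) hd, one_mul]
    calc d ≤ B * p := d2
      _ = (2 * B) * (p / 2) := by ring
      _ ≤ L * (s * D * A ^ ρ) * (p / 2) := mul_le_mul_of_nonneg_right L2 (by positivity)
      _ = s * (D / 2) * (L * (A ^ ρ * p)) := by ring
      _ ≤ s * E * (L * v) := by gcongr
  · rw [div_le_div_iff₀ hd hv]
    calc s * E * v ≤ s * (2 * D) * (B ^ ρ * p) := by gcongr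
      _ = 2 * s * D * B ^ ρ * p := by ring
      _ ≤ L * A * p := mul_le_mul_of_nonneg_right L1 hp.le
      _ = L * (A * p) := by ring
      _ ≤ L * d := by gcongr

theorem isLorenzLike_conj (H : IsFibTent s hs) (hf : f = h ∘ tent s hs ∘ h.symm) :
    IsLorenzLike f (h origin) := by
  obtain ⟨r, hr, l, hl, hbr, hbl⟩ := K.exists_hasPowerBounds
  obtain ⟨ρ₁, hρ₁, L₁, hL₁, hev₁⟩ := K.eventually_lorenz_side H hf hr hbr
  obtain ⟨ρ₂, hρ₂, L₂, hL₂, hev₂⟩ := K.eventually_lorenz_side H hf hl hbl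
  have hmono : ∀ {L L' u ρ d : ℝ}, 0 < L → L ≤ L' → 0 ≤ u →
      1 / (L * u ^ ρ) ≤ d ∧ d ≤ L / u ^ ρ → 1 / (L' * u ^ ρ) ≤ d ∧ d ≤ L' / u ^ ρ := by
    intro L L' u ρ d hL hLL hu ⟨h1, h2⟩
    have hv : 0 ≤ u ^ ρ := Real.rpow_nonneg hu _
    refine ⟨le_trans ?_ h1, h2.trans (div_le_div_of_nonneg_right hLL hv)⟩
    rcases hv.eq_or_lt with h0 | h0
    · rw [← h0]; simp
    · exact one_div_le_one_div_of_le (by positivity) (mul_le_mul_of_nonneg_right hLL hv)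
  have hc : Tendsto h.symm (𝓝 (h origin)) (𝓝 origin) := by
    have := h.symm.continuous.tendsto (h origin)
    rwa [h.symm_apply_apply] at this
  obtain ⟨δ, hδ, hev⟩ := Metric.eventually_nhds_iff.1 ((hc.eventually hev₁).and (hc.eventually hev₂))
  have hL : 0 < max L₁ L₂ := lt_max_of_lt_left hL₁
  have side₁ : ∀ x : Seg, |(x : ℝ) - h origin| < δ → origin < h.symm x →
      1 / (max L₁ L₂ * |(x : ℝ) - h origin| ^ ρ₁) ≤ |der f x| ∧
        |der f x| ≤ max L₁ L₂ / |(x : ℝ) - h origin| ^ ρ₁ := by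
    intro x hx hpos
    have h1 := (hev (y := x) hx).1 (by rw [one_mul]; exact hpos)
    rw [h.apply_symm_apply] at h1
    exact hmono hL₁ (le_max_left _ _) (abs_nonneg _) h1
  have side₂ : ∀ x : Seg, |(x : ℝ) - h origin| < δ → h.symm x < origin →
      1 / (max L₁ L₂ * |(x : ℝ) - h origin| ^ ρ₂) ≤ |der f x| ∧
        |der f x| ≤ max L₁ L₂ / |(x : ℝ) - h origin| ^ ρ₂ := by
    intro x hx hneg
    have hneg' : (h.symm x : ℝ) < 0 := hneg
    have h1 := (hev (y := x) hx).2 (by linarith)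
    rw [h.apply_symm_apply] at h1
    exact hmono hL₂ (le_max_right _ _) (abs_nonneg _) h1
  have near : ∀ x : Seg, ((h origin : Seg) : ℝ) < x → (x : ℝ) < h origin + δ →
      |(x : ℝ) - h origin| < δ := fun x h1 h2 => abs_lt.2 ⟨by linarith, by linarith⟩
  have near' : ∀ x : Seg, ((h origin : Seg) : ℝ) - δ < x → (x : ℝ) < h origin →
      |(x : ℝ) - h origin| < δ := fun x h1 h2 => abs_lt.2 ⟨by linarith, by linarith⟩
  rcases strictMono_or_strictAnti h with hm | hm
  · refine ⟨ρ₁, hρ₁, ρ₂, hρ₂, max L₁ L₂, hL, δ, hδ, fun x h1 h2 => side₁ x (near x h1 h2) ?_,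
      fun x h1 h2 => side₂ x (near' x h1 h2) ?_⟩
    · exact hm.lt_iff_lt.1 (by rw [h.apply_symm_apply]; exact h1)
    · exact hm.lt_iff_lt.1 (by rw [h.apply_symm_apply]; exact h2)
  · refine ⟨ρ₂, hρ₂, ρ₁, hρ₁, max L₁ L₂, hL, δ, hδ, fun x h1 h2 => side₂ x (near x h1 h2) ?_,
      fun x h1 h2 => side₁ x (near' x h1 h2) ?_⟩
    · exact hm.lt_iff_gt.1 (by rw [h.apply_symm_apply]; exact h1)
    · exact hm.lt_iff_gt.1 (by rw [h.apply_symm_apply]; exact h2)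

/-! ### Pointwise exponents and recurrence -/

theorem not_hasPointwiseExponent (H : IsFibTent s hs) (hf : f = h ∘ tent s hs ∘ h.symm) {y : Seg}
    (hy : y ∈ closure (orbit (tent s hs) origin)) (h0 : ∀ n, (tent s hs)^[n] y ≠ origin) :
    ¬ ∃ L : EReal, HasPointwiseExponent f (h y) L := by
  rintro ⟨L, hL⟩
  obtain ⟨a, ha, b, hb, C, hC⟩ := K.exists_log_bounds
  obtain ⟨C', hC'⟩ := K.exists_abs_log_le (by norm_num : (0 : ℝ) < 1 / 10)
  have hls := H.log_slope_pos
  have hy0 : y ≠ origin := h0 0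
  have hlog : ∀ n, Real.log |der f^[n] (h y)| =
      n * Real.log s + Real.log |der h ((tent s hs)^[n] y)| - Real.log |der h y| := fun n =>
    K.log_abs_der_iterate hf hy0 fun i _ => h0 i
  set κ := a * (Real.log s / 3)
  have hκ : 0 < κ := by positivity
  have hbig : ∀ M ε : ℝ, 0 < ε → ∀ᶠ n : ℕ in atTop, 0 < (n : ℝ) ∧ M ≤ ε * n := fun M ε hε => by
    filter_upwards [tendsto_natCast_atTop_atTop.eventually_gt_atTop (0 : ℝ),
      tendsto_natCast_atTop_atTop.eventually_ge_atTop (M / ε)] with n h1 h2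
    refine ⟨h1, ?_⟩
    rw [div_le_iff₀ hε] at h2
    linarith
  -- Close visits push the averages below `log s - κ / 2` ...
  have hlow : ∃ᶠ n : ℕ in atTop, (((1 / (n : ℝ)) * Real.log |der f^[n] (h y)| : ℝ) : EReal) ≤
      ((Real.log s - κ / 2 : ℝ) : EReal) := by
    refine ((H.frequently_log_iterate_le hy fun n hn => h0 n (Subtype.ext hn)).and_eventually
      (hbig (C + a * Real.log 13 - Real.log |der h y|) (κ / 2) (by positivity))).mono ?_
    rintro n ⟨h1, hn, h2⟩
    rw [EReal.coe_le_coe_iff, one_div, inv_mul_le_iff₀ hn, hlog]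
    have h3 := (hC _ (h0 n)).1
    have h4 := mul_le_mul_of_nonneg_left h1 ha.le
    have h5 : a * (Real.log 13 - n * (Real.log s / 3)) = a * Real.log 13 - n * κ := by
      simp only [κ]; ring
    nlinarith
  -- ... while visits away from the turning point bring them back to `log s`.
  have hhigh : ∃ᶠ n : ℕ in atTop, ((Real.log s - κ / 4 : ℝ) : EReal) ≤
      (((1 / (n : ℝ)) * Real.log |der f^[n] (h y)| : ℝ) : EReal) := by
    refine ((H.frequently_le_abs_iterate y).and_eventually
      (hbig (C' + Real.log |der h y|) (κ / 4) (by positivity))).mono ?_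
    rintro n ⟨h1, hn, h2⟩
    rw [EReal.coe_le_coe_iff, one_div, ← div_eq_inv_mul, le_div_iff₀ hn, hlog]
    have h3 := (abs_le.1 (hC' _ h1).1).1
    nlinarith
  have l1 : L ≤ ((Real.log s - κ / 2 : ℝ) : EReal) := le_of_tendsto_of_frequently hL hlow
  have l2 : ((Real.log s - κ / 4 : ℝ) : EReal) ≤ L := ge_of_tendsto_of_frequently hL hhigh
  have := EReal.coe_le_coe_iff.1 (l2.trans l1)
  linarith

/-- If `f ^ n` were differentiable at `h y`, then so would be `T ^ n = h⁻¹ ∘ f ^ n ∘ h` at `y`. This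
holds for `y = 0`, too, as only the differentiability of `h` is used there. -/
theorem not_diffAt_iterate_conj (H : IsFibTent s hs) (hf : f = h ∘ tent s hs ∘ h.symm) {y : Seg}
    {m n : ℕ} (hmn : m < n) (hm : (tent s hs)^[m] y = origin) : ¬ DiffAt f^[n] (h y) := by
  intro hd
  have hne := iterate_ne_origin_of_hit H hmn hm
  refine not_diffAt_iterate_tent H hmn hm ?_
  have h1 := hasDerivWithinAt_comp (hasDerivWithinAt_der hd) (K.hasDerivWithinAt y)
  have h2 := hasDerivWithinAt_symm (K.analytic _ hne) (K.der_ne_zero hne)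
  rw [← iterate_conj_apply hf] at h2
  have h3 := hasDerivWithinAt_comp (f := f^[n] ∘ h) h2 h1
  have e : h.symm ∘ f^[n] ∘ h = (tent s hs)^[n] := by
    funext z
    simp [iterate_conj hf]
  rw [e] at h3
  exact h3.differentiableWithinAt

theorem hasExponentialRecurrence_conj (H : IsFibTent s hs) (hf : f = h ∘ tent s hs ∘ h.symm) :
    HasExponentialRecurrence f (h origin) := by
  have hls := H.log_slope_pos
  have hne : ∀ n, 1 ≤ n → (tent s hs)^[n] origin ≠ origin := fun n hn h0 =>
    H.ne_zero n hn (by rw [crit, h0]; rfl)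
  refine ⟨fun n hn h0 => ?_, ?_, ?_⟩
  · rw [iterate_conj_apply hf] at h0
    exact hne n hn (h.injective h0)
  · obtain ⟨C, hC⟩ := K.exists_log_sub_le
    have hpos : (0 : EReal) < ((Real.log s / 4 : ℝ) : EReal) := by
      rw [EReal.coe_pos]; positivity
    refine hpos.trans_le (le_limsup_of_frequently_le ?_)
    refine (H.frequently_log_crit_le.and_eventually
      ((tendsto_natCast_atTop_atTop.eventually_ge_atTop
        ((C + Real.log 2) / (Real.log s / 4))).and (eventually_ge_atTop 1))).mono ?_
    rintro n ⟨h1, h2, hn⟩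
    have hn0 : (0 : ℝ) < n := by exact_mod_cast hn
    rw [EReal.coe_le_coe_iff, le_div_iff₀ hn0, iterate_conj_apply hf]
    rw [div_le_iff₀ (by positivity)] at h2
    have h3 := hC _ (hne n hn)
    have h4 : Real.log |(((tent s hs)^[n] origin : Seg) : ℝ)| ≤ Real.log 2 - n * (Real.log s / 2) :=
      h1
    nlinarith
  · obtain ⟨a, ha, b, hb, C, hC⟩ := K.exists_log_bounds
    refine lt_of_le_of_lt (limsup_le_of_le (h := ?_))
      (EReal.coe_lt_top (|C - b * Real.log (s - 1)| + b * 16 * Real.log s))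
    filter_upwards [eventually_ge_atTop 1] with n hn
    have hn0 : (1 : ℝ) ≤ n := by exact_mod_cast hn
    rw [EReal.coe_le_coe_iff, div_le_iff₀ (by linarith), iterate_conj_apply hf]
    have h1 := (hC _ (hne n hn)).2
    have hs1 : 0 < s - 1 := by linarith [H.one_lt]
    have h2 := Real.log_le_log (mul_pos hs1 (pow_pos (inv_pos.2 hs.1) _)) (H.le_abs_crit hn)
    rw [log_mul_inv_pow hs1 hs.1] at h2
    have h3 : Real.log |crit s hs n| = Real.log |(((tent s hs)^[n] origin : Seg) : ℝ)| := rfl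
    rw [h3] at h2
    have h4 := mul_le_mul_of_nonneg_left h2 hb.le
    have h5 := le_abs_self (C - b * Real.log (s - 1))
    have h6 := abs_nonneg (C - b * Real.log (s - 1))
    push_cast at h4
    nlinarith

end IsCriticalConjugacy

end Conjugate

/-! ### Integrals with respect to the invariant measure -/

section Integrals

variable {s : ℝ} {hs : s ∈ Ioc (0 : ℝ) 2} {h : Seg ≃ₜ Seg} {f : Seg → Seg}
  {μ : Measure Seg} [IsProbabilityMeasure μ]

/-- A function that is at least `-a * log |y| - b` near the turning point has a positive part of
infinite integral. -/
theorem IsFibTent.lintegral_eq_top (H : IsFibTent s hs)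
    (hμ : MeasurePreserving (tent s hs) μ μ)
    (hsupp : μ (closure (orbit (tent s hs) origin))ᶜ = 0) {G : Seg → ℝ} {a b δ : ℝ} (ha : 0 < a)
    (hδ : 0 < δ) (hG : ∀ y : Seg, y ≠ origin → |(y : ℝ)| < δ → -a * Real.log |(y : ℝ)| - b ≤ G y) :
    ∫⁻ y, ENNReal.ofReal (G y) ∂μ = ⊤ := by
  -- For `|y| < ε`, half of `-a * log |y|` makes up for the constant `b`.
  set ε := min δ (Real.exp (-(2 * b / a)))
  have hε : 0 < ε := lt_min hδ (Real.exp_pos _)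
  have hVm : MeasurableSet {y : Seg | |(y : ℝ)| < ε} :=
    (isOpen_lt continuous_subtype_val.abs continuous_const).measurableSet
  have hne : ∀ᵐ y ∂(μ.restrict {y : Seg | |(y : ℝ)| < ε}), y ≠ origin :=
    ae_restrict_of_ae (compl_mem_ae_iff.2 (H.measure_origin hμ))
  rw [← top_le_iff]
  calc (⊤ : ENNReal) = ENNReal.ofReal (a / 2) *
        (∫⁻ y in {y : Seg | |(y : ℝ)| < ε}, ENNReal.ofReal (-Real.log |(y : ℝ)|) ∂μ) := by
          rw [H.lintegral_neg_log_abs hμ hsupp hε, ENNReal.mul_top]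
          exact (ENNReal.ofReal_pos.2 (by positivity)).ne'
    _ = ∫⁻ y in {y : Seg | |(y : ℝ)| < ε},
        ENNReal.ofReal (a / 2) * ENNReal.ofReal (-Real.log |(y : ℝ)|) ∂μ :=
      (lintegral_const_mul' _ _ ENNReal.ofReal_ne_top).symm
    _ ≤ ∫⁻ y in {y : Seg | |(y : ℝ)| < ε}, ENNReal.ofReal (G y) ∂μ := by
      refine lintegral_mono_ae ?_
      filter_upwards [hne, ae_restrict_mem hVm] with y hy hyε
      rw [← ENNReal.ofReal_mul (by positivity)]
      refine ENNReal.ofReal_le_ofReal (le_trans ?_ (hG y hy (lt_of_lt_of_le hyε (min_le_left _ _))))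
      have hy0 : 0 < |(y : ℝ)| := abs_pos.2 fun h0 => hy (Subtype.ext h0)
      have h1 : Real.log |(y : ℝ)| ≤ -(2 * b / a) := by
        rw [Real.log_le_iff_le_exp hy0]
        exact (lt_of_lt_of_le hyε (min_le_right _ _)).le
      have h2 : a / 2 * (2 * b / a) = b := by field_simp
      nlinarith
    _ ≤ _ := setLIntegral_le_lintegral _ _

namespace IsCriticalConjugacy

variable (K : IsCriticalConjugacy h)
include K

theorem not_lyapunovExponentDefined (H : IsFibTent s hs) (hf : f = h ∘ tent s hs ∘ h.symm)
    (hμ : MeasurePreserving (tent s hs) μ μ)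
    (hsupp : μ (closure (orbit (tent s hs) origin))ᶜ = 0) :
    ¬ LyapunovExponentDefined f (μ.map h) := by
  obtain ⟨a, ha, b, hb, C, hC⟩ := K.exists_log_bounds
  obtain ⟨C', hC'⟩ := K.exists_abs_log_le (by norm_num : (0 : ℝ) < 1 / 10)
  have hs1 := H.slope
  have hemb : MeasurableEmbedding h := h.measurableEmbedding
  unfold LyapunovExponentDefined
  rw [hemb.lintegral_map, hemb.lintegral_map, not_or, not_lt, not_lt, top_le_iff, top_le_iff]
  have htent : ∀ y : Seg, (tent s hs y : ℝ) = s * (1 - |(y : ℝ)|) - 1 := tent_val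
  constructor
  · refine H.lintegral_eq_top hμ hsupp (b := C + C' - Real.log s) ha
      (by norm_num : (0 : ℝ) < 1 / 10) fun y hy hyδ => ?_
    have ht : 1 / 10 ≤ |(tent s hs y : ℝ)| := by
      refine le_trans ?_ (le_abs_self _)
      rw [htent]; nlinarith
    have hty : tent s hs y ≠ origin := by
      intro h0
      have h1 : (tent s hs y : ℝ) = 0 := congrArg Subtype.val h0
      rw [h1, abs_zero] at ht
      norm_num at ht
    rw [K.log_abs_der_conj hf hy hty]
    linarith [(hC y hy).1, (abs_le.1 (hC' _ ht).1).1]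
  -- The negative part is large where `T y` is close to the turning point; the integral is
  -- transported by the invariance of the measure.
  · set V : Set Seg := {z : Seg | |(z : ℝ)| < 1 / 10}
    have hVm : MeasurableSet V :=
      (isOpen_lt continuous_subtype_val.abs continuous_const).measurableSet
    set G : Seg → ℝ := V.indicator
      fun z => -a * Real.log |(z : ℝ)| - (C + C' + Real.log s)
    have hGm : Measurable G := by
      refine Measurable.indicator ?_ hVm
      have : Measurable fun z : Seg => Real.log |(z : ℝ)| :=
        Real.measurable_log.comp continuous_subtype_val.abs.measurable
      exact (this.const_mul (-a)).sub_const _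
    have hGtop : ∫⁻ z, ENNReal.ofReal (G z) ∂μ = ⊤ :=
      H.lintegral_eq_top hμ hsupp (b := C + C' + Real.log s) ha
        (by norm_num : (0 : ℝ) < 1 / 10) fun z _ hz => by
          rw [show G z = _ from indicator_of_mem (show z ∈ V from hz) _]
    rw [← top_le_iff, ← hGtop,
      ← hμ.lintegral_comp (f := fun z => ENNReal.ofReal (G z)) hGm.ennreal_ofReal]
    have hne : ∀ᵐ y ∂μ, tent s hs y ≠ origin :=
      hμ.quasiMeasurePreserving.ae (compl_mem_ae_iff.2 (H.measure_origin hμ))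
    refine lintegral_mono_ae ?_
    filter_upwards [hne] with y hty
    by_cases hV : tent s hs y ∈ V
    · refine ENNReal.ofReal_le_ofReal ?_
      rw [show G (tent s hs y) = _ from indicator_of_mem hV _]
      have hV' : |(tent s hs y : ℝ)| < 1 / 10 := hV
      have hy1 : 1 / 10 ≤ |(y : ℝ)| := by
        have := (abs_lt.1 hV').2
        rw [htent] at this
        nlinarith
      have hy : y ≠ origin := by
        rintro rfl
        have h0 : ((origin : Seg) : ℝ) = 0 := rfl
        rw [h0, abs_zero] at hy1
        norm_num at hy1
      rw [K.log_abs_der_conj hf hy hty]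
      linarith [(hC _ hty).1, (abs_le.1 (hC' _ hy1).1).1]
    · rw [show G (tent s hs y) = 0 from indicator_of_notMem hV _, ENNReal.ofReal_zero]
      exact zero_le

theorem finite_singSet (hf : f = h ∘ tent s hs ∘ h.symm) : (SingSet f (h origin)).Finite := by
  have hsub : SingSet f (h origin) ⊆ h '' (Subtype.val ⁻¹' ({0, 1 - s⁻¹, -(1 - s⁻¹)} : Set ℝ)) := by
    intro x hx
    obtain ⟨y, rfl⟩ := h.surjective x
    refine mem_image_of_mem _ ?_
    rcases (K.mem_singSet hf y).1 hx with rfl | h0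
    · exact Or.inl rfl
    · have h1 : s * (1 - |(y : ℝ)|) - 1 = 0 := congrArg Subtype.val h0
      have h2 : |(y : ℝ)| = 1 - s⁻¹ := by
        have := hs.1.ne'
        field_simp
        linarith
      rcases abs_choice (y : ℝ) with h3 | h3
      · exact Or.inr (Or.inl (by rw [← h2, h3]))
      · exact Or.inr (Or.inr (by rw [mem_singleton_iff, ← h2, h3, neg_neg]))
  exact ((Set.Finite.preimage Subtype.val_injective.injOn (by simp)).image _).subset hsub

theorem not_integrable_log_infDist (H : IsFibTent s hs) (hf : f = h ∘ tent s hs ∘ h.symm)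
    (hμ : MeasurePreserving (tent s hs) μ μ)
    (hsupp : μ (closure (orbit (tent s hs) origin))ᶜ = 0) :
    ¬ Integrable (fun x : Seg => Real.log (Metric.infDist x (SingSet f (h origin)))) (μ.map h) := by
  intro hint
  obtain ⟨C, hC⟩ := K.exists_log_sub_le
  have hs1 := H.slope
  have hemb : MeasurableEmbedding h := h.measurableEmbedding
  have hint' := ((hemb.integrable_map_iff).1 hint).neg.lintegral_lt_top
  refine hint'.ne (H.lintegral_eq_top hμ hsupp (b := C) one_pos
    (by norm_num : (0 : ℝ) < 1 / 10) fun y hy hyδ => ?_)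
  have hmem : h origin ∈ SingSet f (h origin) := Or.inr rfl
  have hnot : h y ∉ SingSet f (h origin) := by
    rw [K.mem_singSet hf, not_or]
    refine ⟨hy, fun h0 => ?_⟩
    have h1 : s * (1 - |(y : ℝ)|) - 1 = 0 := congrArg Subtype.val h0
    nlinarith
  have hpos : 0 < Metric.infDist (h y) (SingSet f (h origin)) :=
    ((K.finite_singSet hf).isClosed.notMem_iff_infDist_pos ⟨_, hmem⟩).1 hnot
  have hle : Metric.infDist (h y) (SingSet f (h origin)) ≤ |(h y : ℝ) - h origin| :=
    Metric.infDist_le_dist_of_mem hmem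
  have h1 := Real.log_le_log hpos hle
  have h2 := hC y hy
  change -1 * Real.log |(y : ℝ)| - C ≤ -Real.log (Metric.infDist (h y) (SingSet f (h origin)))
  linarith

end IsCriticalConjugacy

end Integrals

end LyapunovFibonacci

theorem theorem1
    -- the Fibonacci tent map and its invariant measure on the closure of the turning orbit
    (lam : ℝ) (hlam : lam ∈ Ioc (0 : ℝ) 2)
    (hfib : HasFibonacciRecurrence (tent lam hlam) origin)
    (μ : Measure Seg) [IsProbabilityMeasure μ]
    (hμ : Ergodic (tent lam hlam) μ)
    (hsupp : μ (closure (orbit (tent lam hlam) origin))ᶜ = 0)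
    -- the homeomorphism
    (h : Seg ≃ₜ Seg)
    (han : ∀ x : Seg, x ≠ origin → AnalyticPt h x)
    (hcrit : Crit h = {origin})
    (hnf : IsNonflatCritical h origin)
    -- the conjugate map, its turning point and its measure
    (f : Seg → Seg) (hf : f = h ∘ tent lam hlam ∘ h.symm)
    (c : Seg) (hc : c = h origin)
    (ν : Measure Seg) (hν : ν = μ.map h) :
    -- `f` is a unimodal map (upside down if `h` reverses the orientation), analytic off `S(f)`
    (StrictMono h → IsUnimodal f c) ∧
    (StrictAnti h → IsReversedUnimodal f c) ∧
    (∀ x : Seg, x ∉ SingSet f c → AnalyticPt f x) ∧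
    -- Lorenz-like singularity
    IsLorenzLike f c ∧
    -- (1)
    ¬ LyapunovExponentDefined f ν ∧
    -- (2)
    (∀ x ∈ closure (orbit f c),
      (orbit f x ∩ SingSet f c = ∅ → ¬ ∃ L : EReal, HasPointwiseExponent f x L) ∧
      ((orbit f x ∩ SingSet f c).Nonempty → ∀ᶠ n : ℕ in atTop, ¬ DiffAt f^[n] x)) ∧
    -- (3)
    ¬ Integrable (fun x : Seg => Real.log (Metric.infDist x (SingSet f c))) ν ∧
    -- (4)
    HasExponentialRecurrence f c := by
  have H := isFibTent hfib
  have K : IsCriticalConjugacy h := ⟨han, hcrit, hnf⟩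
  subst hc hν
  refine ⟨isUnimodal_conj hf, isReversedUnimodal_conj hf, fun x => K.analyticPt_conj hf,
    K.isLorenzLike_conj H hf,
    K.not_lyapunovExponentDefined H hf hμ.toMeasurePreserving hsupp, fun x hx => ?_,
    K.not_integrable_log_infDist H hf hμ.toMeasurePreserving hsupp,
    K.hasExponentialRecurrence_conj H hf⟩
  rw [orbit_conj hf, ← h.image_closure] at hx
  obtain ⟨y, hy, rfl⟩ := hx
  constructor
  · intro hempty
    refine K.not_hasPointwiseExponent H hf hy fun n h0 => ?_
    have hmem : f^[n] (h y) ∈ orbit f (h y) ∩ SingSet f (h origin) :=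
      ⟨⟨n, rfl⟩, by rw [iterate_conj_apply hf, h0]; exact Or.inr rfl⟩
    rw [hempty] at hmem
    exact hmem
  · rintro ⟨_, ⟨n, rfl⟩, hn⟩
    obtain ⟨m, hm⟩ : ∃ m, (tent lam hlam)^[m] y = origin := by
      change f^[n] (h y) ∈ _ at hn
      rw [iterate_conj_apply hf, K.mem_singSet hf] at hn
      rcases hn with hn | hn
      · exact ⟨n, hn⟩
      · exact ⟨n + 1, by rw [Function.iterate_succ_apply', hn]⟩
    filter_upwards [eventually_gt_atTop m] with n hn
    exact K.not_diffAt_iterate_conj H hf hn hm
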